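/- Let $K\ge 1$ independent sensors produce, at times $t=1,2,\dots$, observations $X_t=(X_t^1,\dots,X_t^K)$ that are independent over time and across sensors. In sensor $k$ the density with respect to a $\sigma$-finite measure $\lambda_k$ is $h_k$ before the change and $g_k$ after it (if the sensor is affected), and we assume that $I_k=\int \log(g_k/h_k)\,g_k\,d\lambda_k$ is positive and finite. Let $\mathsf P_\infty$ be the law of the observations when no change occurs, and $\mathsf P_\nu^{\mathcal A}$ the law when at time $\nu\in\{0,1,\dots\}$ a change occurs exactly in the sensors of $\mathcal A$ (so that $X_t^k\sim g_k$ iff $t>\nu$ and $k\in\mathcal A$). Let $\mathcal F_t=\sigma(X_s;1\le s\le t)$. For a stopping time $T$ of $(\mathcal F_t)$ put $$\mathcal J_{\mathcal A}[T]=\sup_{\nu\ge 0}\operatorname{ess\,sup}\,\mathsf E_\nu^{\mathcal A}[(T-\nu)^+\mid\mathcal F_\nu],\qquad \mathcal J_k=\mathcal J_{\{k\}},\qquad \mathcal C_\gamma=\{T:\mathsf E_\infty[T]\ge\gamma\}.$$ Let $Z_t^k=\sum_{s=1}^t\log\frac{g_k(X_s^k)}{h_k(X_s^k)}$ and consider,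 for thresholds $b_k>0$, the multichart CUSUM $$S=\min_{1\le k\le K}S^k_{b_k},\qquad S^k_{b}=\inf\{t\ge 1:\ \max_{0\le s<t}(Z_t^k-Z_s^k)\ge b\}.$$ Suppose that $b_k=c_\gamma I_k$ for all $k$, where the constant $c_\gamma>0$ does not depend on $k$ and is chosen so that $\mathsf E_\infty[S]=\gamma$, for all $\gamma$ in an unbounded set $\Gamma$ of levels. Then, for every $k$, $$\lim_{\gamma\to\infty,\ \gamma\in\Gamma}\ \frac{\mathcal J_k[S]}{\inf_{T\in\mathcal C_\gamma}\mathcal J_k[T]}=\frac{I_k}{\min_{1\le j\le K}I_j}.$$ Consequently, with these thresholds the multichart CUSUM is first-order asymptotically optimal with respect to the class of one-element subsets $\{\mathcal A:|\mathcal A|=1\}$ (that is, $\mathcal J_{\mathcal A}[S]/\inf_{T\in\mathcal C_\gamma}\mathcal J_{\mathcal A}[T]\to 1$ as $\gamma\to\infty$, $\gamma\in\Gamma$, for every $\mathcal A$ in this class) if and only if all $I_k$ are equal. -/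

import Mathlib

open MeasureTheory ProbabilityTheory Filter Topology
open scoped ENNReal NNReal

namespace MultichartCusum

/-- `K` independent sensors; sensor `k` takes values in the measurable space `E k` and has the
pre-change density `pre k` (`h_k`) and the post-change density `post k` (`g_k`) with respect to
the σ-finite measure `dom k` (`λ_k`). -/
structure SensorModel (K : ℕ) (E : Fin K → Type*) [∀ k, MeasurableSpace (E k)] where
  dom : ∀ k, Measure (E k)
  sigmaFinite_dom : ∀ k, SigmaFinite (dom k)
  pre : ∀ k, E k → ℝ≥0
  post : ∀ k, E k → ℝ≥0
  measurable_pre : ∀ k, Measurable (pre k)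
  measurable_post : ∀ k, Measurable (post k)
  lintegral_pre : ∀ k, ∫⁻ x, (pre k x : ℝ≥0∞) ∂(dom k) = 1
  lintegral_post : ∀ k, ∫⁻ x, (post k x : ℝ≥0∞) ∂(dom k) = 1

/-- The space of observation sequences. The coordinate `ω n k` is the observation `X_{n+1}^k`
of sensor `k` at time `n + 1`. -/
abbrev Obs {K : ℕ} (E : Fin K → Type*) : Type _ := ℕ → ∀ k, E k

namespace SensorModel

variable {K : ℕ} {E : Fin K → Type*} [∀ k, MeasurableSpace (E k)]

/-- The law of one pre-change observation in sensor `k`. -/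
noncomputable def preLaw (M : SensorModel K E) (k : Fin K) : Measure (E k) :=
  (M.dom k).withDensity fun x => (M.pre k x : ℝ≥0∞)

/-- The law of one post-change observation in sensor `k`. -/
noncomputable def postLaw (M : SensorModel K E) (k : Fin K) : Measure (E k) :=
  (M.dom k).withDensity fun x => (M.post k x : ℝ≥0∞)

instance (M : SensorModel K E) (k : Fin K) : IsProbabilityMeasure (M.preLaw k) :=
  ⟨by rw [preLaw, withDensity_apply _ MeasurableSet.univ, Measure.restrict_univ,
    M.lintegral_pre]⟩

instance (M : SensorModel K E) (k : Fin K) : IsProbabilityMeasure (M.postLaw k) :=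
  ⟨by rw [postLaw, withDensity_apply _ MeasurableSet.univ, Measure.restrict_univ,
    M.lintegral_post]⟩

/-- The integrand `log (g_k / h_k) * g_k` of the Kullback-Leibler number of sensor `k`. -/
noncomputable def klIntegrand (M : SensorModel K E) (k : Fin K) (x : E k) : ℝ :=
  Real.log ((M.post k x : ℝ) / (M.pre k x : ℝ)) * (M.post k x : ℝ)

/-- The Kullback-Leibler number `I_k = ∫ log (g_k / h_k) g_k dλ_k`. -/
noncomputable def klNumber (M : SensorModel K E) (k : Fin K) : ℝ :=
  ∫ x, M.klIntegrand k x ∂(M.dom k)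

/-- The Kullback-Leibler number of sensor `k` is finite: `g_k` vanishes almost everywhere on
`{h_k = 0}` (otherwise the number is `+∞`) and the integral that defines it converges. -/
def FiniteKL (M : SensorModel K E) (k : Fin K) : Prop :=
  (∀ᵐ x ∂(M.dom k), M.pre k x = 0 → M.post k x = 0) ∧ Integrable (M.klIntegrand k) (M.dom k)

/-- `P_∞`: the law of the observations when the change never occurs; the observations are
independent over time and across sensors. -/
noncomputable def noChange (M : SensorModel K E) : Measure (Obs E) :=
  Measure.infinitePi fun _ : ℕ => Measure.pi fun k => M.preLaw k

/-- `P_ν^A`: the law of the observations when the change occurs at time `ν` in the sensors of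
`A`: the observation at time `n + 1` of a sensor in `A` is post-change iff `n + 1 > ν`. -/
noncomputable def change (M : SensorModel K E) (A : Finset (Fin K)) (ν : ℕ) :
    Measure (Obs E) :=
  Measure.infinitePi fun n : ℕ => Measure.pi fun k =>
    if ν < n + 1 ∧ k ∈ A then M.postLaw k else M.preLaw k

end SensorModel

/-- The filtration `F_t = σ(X_s ; 1 ≤ s ≤ t)`, with `F_0` trivial. -/
def obsFiltration {K : ℕ} (E : Fin K → Type*) [∀ k, MeasurableSpace (E k)] :
    Filtration ℕ (inferInstance : MeasurableSpace (Obs E)) where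
  seq t := ⨆ n : ℕ, ⨆ _ : n < t,
    MeasurableSpace.comap (fun ω : Obs E => ω n) inferInstance
  mono' _ _ hst := iSup_mono fun _ => iSup_mono' fun hn => ⟨lt_of_lt_of_le hn hst, le_rfl⟩
  le' _ := iSup_le fun n => iSup_le fun _ => (measurable_pi_apply n).comap_le

namespace SensorModel

variable {K : ℕ} {E : Fin K → Type*} [∀ k, MeasurableSpace (E k)]

/-- `E_∞[T]`. -/
noncomputable def meanTimeToFalseAlarm (M : SensorModel K E) (T : Obs E → ℕ∞) : ℝ≥0∞ :=
  ∫⁻ ω, (T ω : ℝ≥0∞) ∂M.noChange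

/-- Lorden's delay `J_A[T] = sup_{ν ≥ 0} ess sup E_ν^A[(T - ν)^+ | F_ν]`. -/
noncomputable def delay (M : SensorModel K E) (A : Finset (Fin K)) (T : Obs E → ℕ∞) : ℝ≥0∞ :=
  ⨆ ν : ℕ, essSup
    (condLExp (obsFiltration E ν) (M.change A ν) fun ω => ((T ω - (ν : ℕ∞) : ℕ∞) : ℝ≥0∞))
    (M.change A ν)

/-- The class `C_γ` of sequential detection rules `T` with `E_∞[T] ≥ γ`. -/
def falseAlarmClass (M : SensorModel K E) (γ : ℝ) : Set (Obs E → ℕ∞) :=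
  {T | IsStoppingTime (obsFiltration E) T ∧ ENNReal.ofReal γ ≤ M.meanTimeToFalseAlarm T}

/-- The optimal delay `inf_{T ∈ C_γ} J_A[T]`. -/
noncomputable def optimalDelay (M : SensorModel K E) (A : Finset (Fin K)) (γ : ℝ) : ℝ≥0∞ :=
  ⨅ T ∈ M.falseAlarmClass γ, M.delay A T

/-- First-order asymptotic optimality, with respect to the class `P` of possibly affected subsets,
of a family `T` of detection rules indexed by the false alarm levels `γ ∈ Γ`: `T γ ∈ C_γ`, and
for every `A ∈ P` the ratio of `J_A[T γ]` to the optimal delay tends to `1` as `γ → ∞` in `Γ`. -/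
def FirstOrderOptimal (M : SensorModel K E) (P : Set (Finset (Fin K))) (Γ : Set ℝ)
    (T : ℝ → Obs E → ℕ∞) : Prop :=
  (∀ γ ∈ Γ, T γ ∈ M.falseAlarmClass γ) ∧
    ∀ A ∈ P, Tendsto (fun γ => M.delay A (T γ) / M.optimalDelay A γ) (atTop ⊓ 𝓟 Γ) (𝓝 1)

/-- The log-likelihood ratio `log (g_k / h_k)` of one observation in sensor `k`; it is `-∞` where
`g_k` vanishes. -/
noncomputable def logLR (M : SensorModel K E) (k : Fin K) (x : E k) : EReal :=
  ENNReal.log ((M.post k x : ℝ≥0∞) / (M.pre k x : ℝ≥0∞))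

/-- The increment `Z_t^k - Z_s^k = ∑_{s < i ≤ t} ℓ_i^k` of the log-likelihood ratio process of
sensor `k`. -/
noncomputable def logLRIncrement (M : SensorModel K E) (k : Fin K) (s t : ℕ) (ω : Obs E) :
    EReal :=
  ∑ i ∈ Finset.Ico s t, M.logLR k (ω i k)

/-- The CUSUM statistic `Z_t^k - min_{0 ≤ s < t} Z_s^k = max_{0 ≤ s < t} (Z_t^k - Z_s^k)` of
sensor `k` at time `t ≥ 1`. -/
noncomputable def cusumStat (M : SensorModel K E) (k : Fin K) (t : ℕ) (ω : Obs E) : EReal :=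
  ⨆ s ∈ Finset.range t, M.logLRIncrement k s t ω

/-- The CUSUM rule of sensor `k` with threshold `b`: the first time `t ≥ 1` at which the CUSUM
statistic is at least `b` (and `∞` if there is none). -/
noncomputable def cusumTime (M : SensorModel K E) (k : Fin K) (b : ℝ) (ω : Obs E) : ℕ∞ :=
  ⨅ (t : ℕ) (_ : 1 ≤ t ∧ (b : EReal) ≤ M.cusumStat k t ω), (t : ℕ∞)

/-- The multichart CUSUM `min_k S^k_{b_k}`. -/
noncomputable def multichart (M : SensorModel K E) (b : Fin K → ℝ) (ω : Obs E) : ℕ∞ :=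
  ⨅ k, M.cusumTime k (b k) ω

/-- The multichart CUSUM with thresholds `b_k = c I_k`. -/
noncomputable def klMultichart (M : SensorModel K E) (c : ℝ) : Obs E → ℕ∞ :=
  M.multichart fun k => c * M.klNumber k

end SensorModel

end MultichartCusum

/-! Everything is measured on the scale of `log γ`. Let `j` be a sensor with the smallest
Kullback-Leibler number. To first order, the optimal delay in sensor `k` is `log γ / I_k`
(`tendsto_optimalDelay_div_log`), the delay of the multichart rule is `c` whichever sensor is
affected, and the calibration forces `c` to be `log γ / I_j` (`tendsto_calibration_div_log`). The
quotient is `I_k / I_j`, which equals `1` for all `k` exactly when all the numbers agree.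

Upper bounds on delays: a CUSUM restarted at the change never alarms before the original one, so the
worst-case delay is at most the mean alarm time for a change at time `0`. Wald's identity for the
truncated log-likelihood walk bounds that mean by `(1 + ε) b / I_k + C`
(`exists_lintegral_cusumTime_le`), which is `(1 + ε) c + C` for `b = c I_k`.

Lower bounds on delays: a mean of at least `γ` under `P_∞` forces some window of `n` steps, with `n`
slightly below `log γ / I_k`, in which stopping is conditionally very unlikely. Starting the change
at the beginning of this window multiplies probabilities by about `exp (n I_k)` at most, by the law
of large numbers, so stopping stays unlikely (`natCast_le_mul_add_delay`). For the multichart rule,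
until shortly before time `c` the affected chart is held down by the law of large numbers and the
others by Ville's inequality (`eventually_le_delay_klMultichart`).

Calibration: Ville's inequality and a union bound give `E_∞[S] ≥ exp (c I_j) / (4 K) - 1 / 2`, hence
an upper bound for `c`. The lower bound needs no upper estimate of `E_∞[S]`: since `S` itself lies
in `C_γ`, its delay in sensor `j` is at least about `log γ / I_j`, and it is at most `(1 + ε) c +
C`. -/

namespace MultichartCusum

/-! ### Product measures on sequences: densities, shifts and independence -/

section SequenceSpace

/-- It suffices to test on boxes, where the indicator of the box splits over the coordinates and
independence factorizes the integral. -/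
theorem pi_withDensity_prod {ι : Type*} [Fintype ι] {X : ι → Type*} [∀ i, MeasurableSpace (X i)]
    (μ : ∀ i, Measure (X i)) [∀ i, IsProbabilityMeasure (μ i)] (f : ∀ i, X i → ℝ≥0∞)
    (hf : ∀ i, Measurable (f i)) [∀ i, SigmaFinite ((μ i).withDensity (f i))] :
    Measure.pi (fun i => (μ i).withDensity (f i)) =
      (Measure.pi μ).withDensity fun x => ∏ i, f i (x i) := by
  refine Measure.pi_eq fun s hs => ?_
  rw [withDensity_apply _ (MeasurableSet.univ_pi hs),
    ← lintegral_indicator (MeasurableSet.univ_pi hs)]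
  have hind : iIndepFun (fun i (x : ∀ i, X i) => (s i).indicator (f i) (x i)) (Measure.pi μ) :=
    iIndepFun_pi (X := fun i => (s i).indicator (f i))
      fun i => ((hf i).indicator (hs i)).aemeasurable
  have hprod := lintegral_prod_eq_prod_lintegral_of_indepFun Finset.univ _ hind
    fun i => ((hf i).indicator (hs i)).comp (measurable_pi_apply i)
  calc ∫⁻ x, (Set.univ.pi s).indicator (fun x => ∏ i, f i (x i)) x ∂Measure.pi μ
      = ∫⁻ x, ∏ i, (s i).indicator (f i) (x i) ∂Measure.pi μ := by
        refine lintegral_congr fun x => ?_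
        by_cases hx : x ∈ Set.univ.pi s
        · rw [Set.indicator_of_mem hx]
          exact Finset.prod_congr rfl fun i _ =>
            (Set.indicator_of_mem (hx i (Set.mem_univ i)) _).symm
        · rw [Set.indicator_of_notMem hx]
          obtain ⟨i, hi⟩ : ∃ i, x i ∉ s i := by simpa [Set.mem_pi] using hx
          exact (Finset.prod_eq_zero (Finset.mem_univ i) (Set.indicator_of_notMem hi _)).symm
    _ = ∏ i, (μ i).withDensity (f i) (s i) := by
        rw [hprod]
        refine Finset.prod_congr rfl fun i _ => ?_
        rw [withDensity_apply _ (hs i), ← lintegral_indicator (hs i)]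
        exact (measurePreserving_eval μ i).lintegral_comp ((hf i).indicator (hs i))

variable {X : Type*} [MeasurableSpace X]

/-- Events before time `N` are thereby cylinders over a finite product, to which the finite density
formula applies. -/
theorem iSup_comap_eval_eq_comap_restrict (N : ℕ) :
    (⨆ n : ℕ, ⨆ _ : n < N, MeasurableSpace.comap (fun ω : ℕ → X => ω n) inferInstance) =
      MeasurableSpace.comap (Finset.range N).restrict MeasurableSpace.pi := by
  apply le_antisymm
  · refine iSup_le fun n => iSup_le fun hn => ?_
    have : (fun ω : ℕ → X => ω n) =
        (fun x : (i : Finset.range N) → X => x ⟨n, Finset.mem_range.2 hn⟩) ∘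
          (Finset.range N).restrict := rfl
    rw [this, ← MeasurableSpace.comap_comp]
    exact MeasurableSpace.comap_mono (measurable_pi_apply _).comap_le
  · rw [MeasurableSpace.pi, MeasurableSpace.comap_iSup]
    refine iSup_le fun i => ?_
    rw [MeasurableSpace.comap_comp]
    exact le_iSup₂_of_le i.1 (Finset.mem_range.1 i.2) le_rfl

/-- Likelihood ratio identity for product measures on the events before time `N`. -/
theorem infinitePi_apply_eq_setLIntegral_prod {μ μ' : ℕ → Measure X}
    [∀ n, IsProbabilityMeasure (μ n)] [∀ n, IsProbabilityMeasure (μ' n)] {f : ℕ → X → ℝ≥0∞}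
    (hf : ∀ n, Measurable (f n)) {N : ℕ} (h : ∀ n < N, μ' n = (μ n).withDensity (f n))
    {A : Set (ℕ → X)}
    (hA : MeasurableSet[⨆ n : ℕ, ⨆ _ : n < N,
      MeasurableSpace.comap (fun ω : ℕ → X => ω n) inferInstance] A) :
    Measure.infinitePi μ' A =
      ∫⁻ ω in A, ∏ n ∈ Finset.range N, f n (ω n) ∂Measure.infinitePi μ := by
  rw [iSup_comap_eval_eq_comap_restrict] at hA
  obtain ⟨B, hB, rfl⟩ := hA
  have hr : Measurable fun ω : ℕ → X => (Finset.range N).restrict ω := by fun_prop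
  have key : Measure.pi (fun i : Finset.range N => μ' i) =
      (Measure.pi fun i : Finset.range N => μ i).withDensity
        fun x : Finset.range N → X => ∏ i : Finset.range N, f i (x i) := by
    have hi : ∀ i : Finset.range N, μ' i = (μ i).withDensity (f i) :=
      fun i => h i (Finset.mem_range.1 i.2)
    have : ∀ i : Finset.range N, SigmaFinite ((μ i).withDensity (f i)) := fun i => by
      rw [← hi i]; infer_instance
    simp_rw [hi]
    exact pi_withDensity_prod (fun i : Finset.range N => μ i) (fun i : Finset.range N => f i)
      fun i => hf i
  rw [← Measure.map_apply hr hB, Measure.infinitePi_map_restrict, key, withDensity_apply _ hB,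
    ← Measure.infinitePi_map_restrict, setLIntegral_map hB (by fun_prop) hr]
  refine lintegral_congr fun ω => ?_
  simp only [Finset.restrict]
  exact Finset.prod_coe_sort (Finset.range N) fun n => f n (ω n)

/-- The shift by `ν` of an observation sequence. -/
def shift (ν : ℕ) (ω : ℕ → X) : ℕ → X := fun n => ω (n + ν)

theorem measurable_shift (ν : ℕ) : Measurable (shift (X := X) ν) := by
  unfold shift; fun_prop

theorem infinitePi_map_shift (μ : ℕ → Measure X) [∀ n, IsProbabilityMeasure (μ n)] (ν : ℕ) :
    (Measure.infinitePi μ).map (shift ν) = Measure.infinitePi fun n => μ (n + ν) :=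
  Measure.map_infinitePi_infinitePi_of_inj (f := fun n => n + ν) (add_left_injective ν)

/-- The future after time `ν` is independent of the events before time `ν`. -/
theorem setLIntegral_comp_shift (μ : ℕ → Measure X) [∀ n, IsProbabilityMeasure (μ n)] (ν : ℕ)
    {A : Set (ℕ → X)}
    (hA : MeasurableSet[⨆ n : ℕ, ⨆ _ : n < ν,
      MeasurableSpace.comap (fun ω : ℕ → X => ω n) inferInstance] A)
    {g : (ℕ → X) → ℝ≥0∞} (hg : Measurable g) :
    ∫⁻ ω in A, g (shift ν ω) ∂Measure.infinitePi μ =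
      Measure.infinitePi μ A * ∫⁻ ω, g ω ∂Measure.infinitePi fun n => μ (n + ν) := by
  have hle : ∀ n : ℕ, MeasurableSpace.comap (fun ω : ℕ → X => ω n) inferInstance ≤
      (inferInstance : MeasurableSpace (ℕ → X)) := fun n => (measurable_pi_apply n).comap_le
  have hind : iIndep (fun n : ℕ => MeasurableSpace.comap (fun ω : ℕ → X => ω n) inferInstance)
      (Measure.infinitePi μ) :=
    iIndepFun_infinitePi (P := μ) (X := fun _ x => x) fun _ => measurable_id
  have hdisj : Disjoint {n : ℕ | n < ν} {n : ℕ | ν ≤ n} :=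
    Set.disjoint_left.2 fun n (h1 : n < ν) (h2 : ν ≤ n) => absurd h1 (not_lt.2 h2)
  have hI := indep_iSup_of_disjoint hle hind hdisj
  have hA' : MeasurableSet A := (iSup₂_le fun n _ => hle n) A hA
  have hgm : Measurable[⨆ n ∈ {n : ℕ | ν ≤ n},
      MeasurableSpace.comap (fun ω : ℕ → X => ω n) inferInstance] fun ω => g (shift ν ω) := by
    refine @Measurable.comp _ _ _ (⨆ n ∈ {n : ℕ | ν ≤ n},
      MeasurableSpace.comap (fun ω : ℕ → X => ω n) inferInstance) _ _ g (shift ν) hg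
      (@measurable_pi_lambda _ _ _ (_) _ _ fun n => ?_)
    exact (comap_measurable (fun ω : ℕ → X => ω (n + ν))).mono
      (le_iSup₂_of_le (n + ν) (Nat.le_add_left ν n) le_rfl) le_rfl
  have hAm : Measurable[⨆ n ∈ {n : ℕ | n < ν},
      MeasurableSpace.comap (fun ω : ℕ → X => ω n) inferInstance]
      (A.indicator fun _ => (1 : ℝ≥0∞)) := measurable_const.indicator hA
  have := lintegral_mul_eq_lintegral_mul_lintegral_of_independent_measurableSpace
    (iSup₂_le fun n _ => hle n) (iSup₂_le fun n _ => hle n) hI hAm hgm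
  rw [← infinitePi_map_shift, lintegral_map hg (measurable_shift ν)]
  rw [lintegral_indicator hA', setLIntegral_const, one_mul] at this
  rw [← this, ← lintegral_indicator hA']
  refine lintegral_congr fun ω => ?_
  by_cases h : ω ∈ A <;> simp [h]

end SequenceSpace

end MultichartCusum

namespace MultichartCusum

/-! ### Laws, likelihood ratios and stopping times of the sensor model -/

section Model

variable {K : ℕ} {E : Fin K → Type*} [∀ k, MeasurableSpace (E k)]

namespace SensorModel

/-- The law of one observation when the sensors of `A` are post-change. -/
noncomputable def obsLaw (M : SensorModel K E) (A : Finset (Fin K)) : Measure (∀ k, E k) :=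
  Measure.pi fun k => if k ∈ A then M.postLaw k else M.preLaw k

instance (M : SensorModel K E) (A : Finset (Fin K)) (k : Fin K) :
    IsProbabilityMeasure (if k ∈ A then M.postLaw k else M.preLaw k) := by
  split_ifs <;> infer_instance

instance (M : SensorModel K E) (A : Finset (Fin K)) : IsProbabilityMeasure (M.obsLaw A) := by
  unfold obsLaw; infer_instance

/-- The law of the observations when the sensors of `D n` are post-change at time `n + 1`. -/
noncomputable def law (M : SensorModel K E) (D : ℕ → Finset (Fin K)) : Measure (Obs E) :=
  Measure.infinitePi fun n => M.obsLaw (D n)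

instance (M : SensorModel K E) (D : ℕ → Finset (Fin K)) : IsProbabilityMeasure (M.law D) := by
  unfold law; infer_instance

theorem noChange_eq_law (M : SensorModel K E) : M.noChange = M.law fun _ => ∅ := by
  simp [noChange, law, obsLaw]

theorem change_eq_law (M : SensorModel K E) (A : Finset (Fin K)) (ν : ℕ) :
    M.change A ν = M.law fun n => if ν ≤ n then A else ∅ := by
  unfold change law obsLaw
  congr 1
  ext1 n
  congr 1
  ext1 k
  by_cases h : ν ≤ n <;> simp [h]

theorem change_zero_eq_law (M : SensorModel K E) (A : Finset (Fin K)) :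
    M.change A 0 = M.law fun _ => A := by
  simp [change_eq_law]

/-- The likelihood ratio `g_k / h_k` of one observation. -/
noncomputable def lr (M : SensorModel K E) (k : Fin K) (x : E k) : ℝ≥0∞ :=
  (M.post k x : ℝ≥0∞) / (M.pre k x : ℝ≥0∞)

@[fun_prop]
theorem measurable_lr (M : SensorModel K E) (k : Fin K) : Measurable (M.lr k) :=
  ((M.measurable_post k).coe_nnreal_ennreal).div ((M.measurable_pre k).coe_nnreal_ennreal)

/-- The likelihood ratio of sensor `k` between the times `s` and `t`. -/
noncomputable def lrProd (M : SensorModel K E) (k : Fin K) (s t : ℕ) (ω : Obs E) : ℝ≥0∞ :=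
  ∏ i ∈ Finset.Ico s t, M.lr k (ω i k)

/-- Passing to products in `ℝ≥0∞` avoids `-∞`; the conventions `⊥ + ⊤ = ⊥` and `0 * ⊤ = 0` match
under the logarithm. -/
theorem logLRIncrement_eq_log_lrProd (M : SensorModel K E) (k : Fin K) (s t : ℕ) (ω : Obs E) :
    M.logLRIncrement k s t ω = ENNReal.log (M.lrProd k s t ω) := by
  unfold logLRIncrement lrProd
  induction Finset.Ico s t using Finset.induction_on with
  | empty => simp
  | insert a S ha ih =>
    rw [Finset.sum_insert ha, Finset.prod_insert ha, ENNReal.log_mul_add, ih]; rfl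

/-- Finiteness of the Kullback-Leibler number contains absolute continuity: where `h_k = 0`, both
sides have density `0`, whatever value the quotient takes there. -/
theorem postLaw_eq_withDensity (M : SensorModel K E) {k : Fin K} (hk : M.FiniteKL k) :
    M.postLaw k = (M.preLaw k).withDensity (M.lr k) := by
  have hp := (M.measurable_pre k).coe_nnreal_ennreal
  rw [preLaw, ← withDensity_mul _ hp (M.measurable_lr k), postLaw]
  refine withDensity_congr_ae ?_
  filter_upwards [hk.1] with x hx
  by_cases h : M.pre k x = 0
  · simp [h, hx h]
  · simp only [Pi.mul_apply, lr]
    rw [ENNReal.mul_div_cancel (by simpa using h) (by simp)]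

theorem obsLaw_insert (M : SensorModel K E) {A : Finset (Fin K)} {j : Fin K} (hj : j ∉ A)
    (hk : M.FiniteKL j) :
    M.obsLaw (insert j A) = (M.obsLaw A).withDensity fun x => M.lr j (x j) := by
  have hf : ∀ k, (if k ∈ insert j A then M.postLaw k else M.preLaw k) =
      (if k ∈ A then M.postLaw k else M.preLaw k).withDensity
        (if k = j then M.lr k else fun _ => 1) := by
    intro k
    by_cases h : k = j
    · subst h; simp [hj, M.postLaw_eq_withDensity hk]
    · simp [h]
  have : ∀ k, SigmaFinite ((if k ∈ A then M.postLaw k else M.preLaw k).withDensity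
        (if k = j then M.lr k else fun _ => 1)) := fun k => by rw [← hf k]; infer_instance
  unfold obsLaw
  simp_rw [hf]
  rw [pi_withDensity_prod]
  · congr 1
    ext1 x
    rw [Finset.prod_eq_single j]
    · simp
    · intro k _ h; simp [h]
    · simp
  · intro k
    split_ifs
    · exact M.measurable_lr k
    · exact measurable_const

theorem setLIntegral_law_comp_shift (M : SensorModel K E) (D : ℕ → Finset (Fin K)) (ν : ℕ)
    {A : Set (Obs E)} (hA : MeasurableSet[obsFiltration E ν] A)
    {g : Obs E → ℝ≥0∞} (hg : Measurable g) :
    ∫⁻ ω in A, g (shift ν ω) ∂M.law D = M.law D A * ∫⁻ ω, g ω ∂M.law fun n => D (n + ν) :=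
  setLIntegral_comp_shift _ ν hA hg

/-- Laws that agree up to time `N` agree on the events before time `N`. -/
theorem law_apply_congr (M : SensorModel K E) {D D' : ℕ → Finset (Fin K)} {N : ℕ}
    (h : ∀ n < N, D n = D' n) {A : Set (Obs E)} (hA : MeasurableSet[obsFiltration E N] A) :
    M.law D A = M.law D' A := by
  have := infinitePi_apply_eq_setLIntegral_prod (μ := fun n => M.obsLaw (D' n))
    (μ' := fun n => M.obsLaw (D n)) (f := fun _ _ => 1) (fun _ => measurable_const)
    (N := N) (fun n hn => by rw [h n hn]; exact withDensity_one.symm) hA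
  rw [law, this]
  simp [law]

/-- Likelihood ratio identity: sensor `k` additionally changes at time `s`. -/
theorem law_apply_eq_setLIntegral_lrProd (M : SensorModel K E) {D D' : ℕ → Finset (Fin K)}
    {k : Fin K} (hk : M.FiniteKL k) {s t : ℕ} (h1 : ∀ n < s, D' n = D n)
    (h2 : ∀ n, s ≤ n → n < t → k ∉ D n ∧ D' n = insert k (D n)) {A : Set (Obs E)}
    (hA : MeasurableSet[obsFiltration E t] A) :
    M.law D' A = ∫⁻ ω in A, M.lrProd k s t ω ∂M.law D := by
  have := infinitePi_apply_eq_setLIntegral_prod (μ := fun n => M.obsLaw (D n))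
    (μ' := fun n => M.obsLaw (D' n)) (f := fun n x => if s ≤ n then M.lr k (x k) else 1)
    (fun n => by split_ifs <;> fun_prop) (N := t) (fun n hn => by
      split_ifs with hs
      · rw [(h2 n hs hn).2, M.obsLaw_insert (h2 n hs hn).1 hk]
      · rw [h1 n (not_le.1 hs)]; exact withDensity_one.symm) hA
  rw [law, this, law]
  refine lintegral_congr fun ω => ?_
  rw [lrProd, Finset.prod_ite, Finset.prod_const_one, mul_one]
  refine Finset.prod_congr ?_ fun _ _ => rfl
  ext i
  simp [and_comm]

theorem measurable_lrProd_obsFiltration (M : SensorModel K E) (k : Fin K) {s t n : ℕ}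
    (htn : t ≤ n) : Measurable[obsFiltration E n] (M.lrProd k s t) := by
  refine Finset.measurable_fun_prod _ fun i hi => ?_
  have h : Measurable[obsFiltration E n] fun ω : Obs E => ω i :=
    (comap_measurable (fun ω : Obs E => ω i)).mono
      (le_iSup₂_of_le i ((Finset.mem_Ico.1 hi).2.trans_le htn) le_rfl) le_rfl
  exact ((M.measurable_lr k).comp (measurable_pi_apply k)).comp h

theorem measurable_lrProd (M : SensorModel K E) (k : Fin K) (s t : ℕ) :
    Measurable (M.lrProd k s t) :=
  (M.measurable_lrProd_obsFiltration k le_rfl).mono ((obsFiltration E).le t) le_rfl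

/-- The maximum over the finitely many starting times `s < t` is attained. All later path arguments
use this form. -/
theorem cusumTime_le_iff (M : SensorModel K E) (k : Fin K) (b : ℝ) (ω : Obs E) (n : ℕ) :
    M.cusumTime k b ω ≤ n ↔
      ∃ t ≤ n, ∃ s < t, ENNReal.ofReal (Real.exp b) ≤ M.lrProd k s t ω := by
  have hlog : (b : EReal) = ENNReal.log (ENNReal.ofReal (Real.exp b)) := by
    rw [ENNReal.log_ofReal_of_pos (Real.exp_pos b), Real.log_exp]
  have hstat : ∀ t, 1 ≤ t → ((b : EReal) ≤ M.cusumStat k t ω ↔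
      ∃ s < t, ENNReal.ofReal (Real.exp b) ≤ M.lrProd k s t ω) := by
    intro t ht
    have hne : (Finset.range t).Nonempty := Finset.nonempty_range_iff.2 (by omega)
    rw [cusumStat, ← Finset.sup_eq_iSup, Finset.le_sup_iff (EReal.bot_lt_coe b)]
    simp only [logLRIncrement_eq_log_lrProd, hlog, ENNReal.log_le_log_iff, Finset.mem_range]
  constructor
  · intro h
    by_contra hcon
    have : ((n : ℕ∞) + 1) ≤ M.cusumTime k b ω := by
      refine le_iInf₂ fun t ht => ?_
      by_contra hlt
      have htn : t ≤ n := by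
        have : (t : ℕ∞) < ((n + 1 : ℕ) : ℕ∞) := by push_cast; exact not_le.1 hlt
        have := Nat.cast_lt.1 this
        omega
      exact hcon ⟨t, htn, (hstat t ht.1).1 ht.2⟩
    have := this.trans h
    exact absurd this (by exact_mod_cast Nat.not_succ_le_self n)
  · rintro ⟨t, htn, s, hst, h⟩
    have ht : 1 ≤ t := by omega
    exact (iInf₂_le t ⟨ht, (hstat t ht).2 ⟨s, hst, h⟩⟩).trans (by exact_mod_cast htn)

theorem isStoppingTime_cusumTime (M : SensorModel K E) (k : Fin K) (b : ℝ) :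
    IsStoppingTime (obsFiltration E) (M.cusumTime k b) := by
  intro n
  have : {ω | M.cusumTime k b ω ≤ (n : ℕ∞)} =
      ⋃ t ∈ {t | t ≤ n}, ⋃ s ∈ {s | s < t},
        {ω | ENNReal.ofReal (Real.exp b) ≤ M.lrProd k s t ω} := by
    ext ω
    simp [cusumTime_le_iff]
  change MeasurableSet[obsFiltration E n] {ω | M.cusumTime k b ω ≤ (n : ℕ∞)}
  rw [this]
  refine MeasurableSet.biUnion (Set.to_countable _) fun t ht =>
    MeasurableSet.biUnion (Set.to_countable _) fun s _ => ?_
  exact measurableSet_le measurable_const (M.measurable_lrProd_obsFiltration k ht)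

theorem multichart_le_iff (M : SensorModel K E) (b : Fin K → ℝ) (ω : Obs E) (n : ℕ) :
    M.multichart b ω ≤ n ↔ ∃ k, M.cusumTime k (b k) ω ≤ n := by
  constructor
  · intro h
    by_contra! hcon
    have : ((n : ℕ∞) + 1) ≤ M.multichart b ω := le_iInf fun k => Order.add_one_le_of_lt (hcon k)
    exact absurd (this.trans h) (by exact_mod_cast Nat.not_succ_le_self n)
  · rintro ⟨k, hk⟩
    exact (iInf_le _ k).trans hk

theorem isStoppingTime_multichart (M : SensorModel K E) (b : Fin K → ℝ) :
    IsStoppingTime (obsFiltration E) (M.multichart b) := by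
  intro n
  have : {ω | M.multichart b ω ≤ (n : ℕ∞)} = ⋃ k, {ω | M.cusumTime k (b k) ω ≤ (n : ℕ∞)} := by
    ext ω
    simp [multichart_le_iff]
  change MeasurableSet[obsFiltration E n] {ω | M.multichart b ω ≤ (n : ℕ∞)}
  rw [this]
  exact MeasurableSet.iUnion fun k => M.isStoppingTime_cusumTime k (b k) n

theorem lrProd_shift (M : SensorModel K E) (k : Fin K) (ν s t : ℕ) (ω : Obs E) :
    M.lrProd k s t (shift ν ω) = M.lrProd k (s + ν) (t + ν) ω := by
  simp only [lrProd, shift]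
  rw [← Finset.prod_Ico_add' (fun i => M.lr k (ω i k))]

/-- The CUSUM rule restarted at time `ν` does not stop before the original one. -/
theorem cusumTime_le_add_shift (M : SensorModel K E) (k : Fin K) (b : ℝ) (ν : ℕ) (ω : Obs E) :
    M.cusumTime k b ω ≤ M.cusumTime k b (shift ν ω) + ν := by
  rcases eq_or_ne (M.cusumTime k b (shift ν ω)) ⊤ with h | h
  · simp [h]
  · obtain ⟨n, hn⟩ := ENat.ne_top_iff_exists.1 h
    obtain ⟨t, ht, s, hs, hL⟩ := (M.cusumTime_le_iff k b (shift ν ω) n).1 hn.ge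
    rw [lrProd_shift] at hL
    rw [← hn]
    exact_mod_cast (M.cusumTime_le_iff k b ω (n + ν)).2 ⟨t + ν, by omega, s + ν, by omega, hL⟩

end SensorModel

/-- Pointwise form of the tail-sum formula for the mean. -/
theorem toENNReal_eq_tsum_ite (x : ℕ∞) :
    (x : ℝ≥0∞) = ∑' n : ℕ, if (n : ℕ∞) < x then 1 else 0 := by
  induction x using ENat.recTopCoe with
  | top => simp
  | coe m =>
    rw [tsum_eq_sum (s := Finset.range m) fun n hn => by
      simpa using (Finset.mem_range.not.1 hn)]
    rw [Finset.sum_congr rfl fun (n : ℕ) (hn : n ∈ Finset.range m) =>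
      if_pos (Nat.cast_lt.2 (Finset.mem_range.1 hn) : (n : ℕ∞) < (m : ℕ∞))]
    simp

theorem measurableSet_obsFiltration_le {T : Obs E → ℕ∞}
    (hT : IsStoppingTime (obsFiltration E) T) (n : ℕ) :
    MeasurableSet[obsFiltration E n] {ω | T ω ≤ (n : ℕ∞)} :=
  hT n

theorem measurableSet_obsFiltration_lt {T : Obs E → ℕ∞}
    (hT : IsStoppingTime (obsFiltration E) T) (n : ℕ) :
    MeasurableSet[obsFiltration E n] {ω | (n : ℕ∞) < T ω} := by
  have : {ω | (n : ℕ∞) < T ω} = {ω | T ω ≤ (n : ℕ∞)}ᶜ := by ext ω; simp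
  rw [this]
  exact (measurableSet_obsFiltration_le hT n).compl

/-- A stopping time of the observations is measurable. -/
theorem measurable_of_isStoppingTime {T : Obs E → ℕ∞}
    (hT : IsStoppingTime (obsFiltration E) T) : Measurable fun ω => (T ω : ℝ≥0∞) := by
  have hset : ∀ n : ℕ, MeasurableSet {ω | T ω ≤ (n : ℕ∞)} :=
    fun n => (obsFiltration E).le n _ (measurableSet_obsFiltration_le hT n)
  have : (fun ω => (T ω : ℝ≥0∞)) =
      fun ω => ∑' n : ℕ, ({ω | T ω ≤ (n : ℕ∞)}ᶜ).indicator (fun _ => (1 : ℝ≥0∞)) ω := by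
    ext ω
    rw [toENNReal_eq_tsum_ite]
    refine tsum_congr fun n => ?_
    by_cases h : (n : ℕ∞) < T ω
    · simp [h]
    · simp [h, not_lt.1 h]
  rw [this]
  exact Measurable.tsum fun n => measurable_const.indicator (hset n).compl

theorem lintegral_toENNReal_eq_tsum (μ : Measure (Obs E)) {T : Obs E → ℕ∞}
    (hT : IsStoppingTime (obsFiltration E) T) :
    ∫⁻ ω, (T ω : ℝ≥0∞) ∂μ = ∑' n : ℕ, μ {ω | (n : ℕ∞) < T ω} := by
  have hset : ∀ n : ℕ, MeasurableSet {ω | (n : ℕ∞) < T ω} := fun n =>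
    (obsFiltration E).le n _ (measurableSet_obsFiltration_lt hT n)
  simp_rw [toENNReal_eq_tsum_ite]
  rw [lintegral_tsum fun n => (Measurable.ite (hset n) measurable_const
    measurable_const).aemeasurable]
  refine tsum_congr fun n => ?_
  rw [← lintegral_indicator_one (hset n)]
  refine lintegral_congr fun ω => ?_
  by_cases h : (n : ℕ∞) < T ω <;> simp [h]

end Model

end MultichartCusum

namespace MultichartCusum

/-! ### Ville's inequality and lower bounds for the mean time to false alarm -/

section FalseAlarm

variable {K : ℕ} {E : Fin K → Type*} [∀ k, MeasurableSpace (E k)]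

namespace SensorModel

/-- Ville's inequality for the likelihood ratio process started at time `s`. -/
theorem law_exists_le_lrProd_le (M : SensorModel K E) {D : ℕ → Finset (Fin K)} {j : Fin K}
    (hj : M.FiniteKL j) (hD : ∀ n, j ∉ D n) (b : ℝ) (s n : ℕ) :
    M.law D {ω | ∃ t ≤ n, s < t ∧ ENNReal.ofReal (Real.exp b) ≤ M.lrProd j s t ω} ≤
      ENNReal.ofReal (Real.exp (-b)) := by
  -- For `t > s`, `B t` is first passage over `exp b` at time `t`. For `t ≤ s` the product is empty,
  -- so these `t` are discarded below by intersecting with `s < t`.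
  set B : ℕ → Set (Obs E) := fun t => {ω | ENNReal.ofReal (Real.exp b) ≤ M.lrProd j s t ω ∧
    ∀ u < t, s < u → ¬ ENNReal.ofReal (Real.exp b) ≤ M.lrProd j s u ω}
  -- Under `D'` sensor `j` also changes at `s`. On `B t` the density of this law is at least `exp
  -- b`, and the disjoint first-passage events have total probability at most `1` under it.
  set D' : ℕ → Finset (Fin K) := fun i => if i < s then D i else insert j (D i)
  have hBm : ∀ t, MeasurableSet[obsFiltration E t] (B t) := by
    intro t
    refine MeasurableSet.inter (measurableSet_le measurable_const
      (M.measurable_lrProd_obsFiltration j le_rfl)) ?_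
    have : {ω | ∀ u < t, s < u → ¬ ENNReal.ofReal (Real.exp b) ≤ M.lrProd j s u ω} =
        ⋂ u ∈ {u | u < t}, ⋂ (_ : s < u),
          {ω | ENNReal.ofReal (Real.exp b) ≤ M.lrProd j s u ω}ᶜ := by
      ext ω; simp
    change MeasurableSet[obsFiltration E t] {ω | ∀ u < t, s < u →
      ¬ ENNReal.ofReal (Real.exp b) ≤ M.lrProd j s u ω}
    rw [this]
    refine MeasurableSet.biInter (Set.to_countable _) fun u hu =>
      MeasurableSet.iInter fun _ => MeasurableSet.compl ?_
    exact measurableSet_le measurable_const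
      (M.measurable_lrProd_obsFiltration j (le_of_lt hu))
  have hB : ∀ t, M.law D (B t) ≤ ENNReal.ofReal (Real.exp (-b)) * M.law D' (B t) := by
    intro t
    have h := M.law_apply_eq_setLIntegral_lrProd (D := D) (D' := D') hj (s := s) (t := t)
      (fun n hn => by simp [D', hn]) (fun n hn _ => ⟨hD n, by simp [D', not_lt.2 hn]⟩) (hBm t)
    have h2 : ENNReal.ofReal (Real.exp b) * M.law D (B t) ≤ M.law D' (B t) := by
      rw [h, ← setLIntegral_const]
      exact setLIntegral_mono' ((obsFiltration E).le t _ (hBm t)) fun ω hω => hω.1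
    calc M.law D (B t)
        = ENNReal.ofReal (Real.exp (-b)) * (ENNReal.ofReal (Real.exp b) * M.law D (B t)) := by
          rw [← mul_assoc, ← ENNReal.ofReal_mul (Real.exp_pos _).le, ← Real.exp_add]
          simp
      _ ≤ _ := by gcongr
  have hdisj : Pairwise (Function.onFun Disjoint fun t => B t ∩ {_ω | s < t}) := by
    intro t u htu
    refine Set.disjoint_left.2 fun ω h1 h2 => ?_
    rcases lt_or_gt_of_ne htu with h | h
    · exact h2.1.2 t h h1.2 h1.1.1
    · exact h1.1.2 u h h2.2 h2.1.1
  have hm : ∀ t, MeasurableSet (B t ∩ {_ω | s < t}) := fun t =>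
    ((obsFiltration E).le t _ (hBm t)).inter (MeasurableSet.const _)
  have hsub : {ω | ∃ t ≤ n, s < t ∧ ENNReal.ofReal (Real.exp b) ≤ M.lrProd j s t ω} ⊆
      ⋃ t, B t ∩ {_ω | s < t} := by
    rintro ω ⟨t, -, hst, hL⟩
    classical
    have hex : ∃ t, s < t ∧ ENNReal.ofReal (Real.exp b) ≤ M.lrProd j s t ω := ⟨t, hst, hL⟩
    refine Set.mem_iUnion.2 ⟨Nat.find hex, ⟨(Nat.find_spec hex).2, fun u hu hsu hLu => ?_⟩,
      (Nat.find_spec hex).1⟩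
    exact Nat.find_min hex hu ⟨hsu, hLu⟩
  calc _ ≤ M.law D (⋃ t, B t ∩ {_ω | s < t}) := measure_mono hsub
    _ ≤ ∑' t, M.law D (B t ∩ {_ω | s < t}) := measure_iUnion_le _
    _ ≤ ∑' t, ENNReal.ofReal (Real.exp (-b)) * M.law D' (B t ∩ {_ω | s < t}) := by
        refine ENNReal.tsum_le_tsum fun t => ?_
        by_cases h : s < t
        · simpa [h] using hB t
        · simp [h]
    _ = ENNReal.ofReal (Real.exp (-b)) * M.law D' (⋃ t, B t ∩ {_ω | s < t}) := by
        rw [ENNReal.tsum_mul_left, measure_iUnion hdisj hm]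
    _ ≤ _ := mul_le_of_le_one_right' prob_le_one

/-- Union bound over the `n` starting times. Only sensor `j` has to remain unchanged, so the
estimate covers `P_∞` as well as the unaffected charts after a change elsewhere. -/
theorem law_cusumTime_le_le (M : SensorModel K E) {D : ℕ → Finset (Fin K)} {j : Fin K}
    (hj : M.FiniteKL j) (hD : ∀ n, j ∉ D n) (b : ℝ) (n : ℕ) :
    M.law D {ω | M.cusumTime j b ω ≤ n} ≤ n * ENNReal.ofReal (Real.exp (-b)) := by
  have hsub : {ω | M.cusumTime j b ω ≤ n} ⊆ ⋃ s ∈ Finset.range n,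
      {ω | ∃ t ≤ n, s < t ∧ ENNReal.ofReal (Real.exp b) ≤ M.lrProd j s t ω} := by
    intro ω hω
    obtain ⟨t, ht, s, hs, hL⟩ := (M.cusumTime_le_iff j b ω n).1 hω
    exact Set.mem_biUnion (Finset.mem_coe.2 (Finset.mem_range.2 (hs.trans_le ht))) ⟨t, ht, hs, hL⟩
  calc _ ≤ _ := measure_mono hsub
    _ ≤ _ := measure_biUnion_finset_le _ _
    _ ≤ ∑ s ∈ Finset.range n, ENNReal.ofReal (Real.exp (-b)) :=
        Finset.sum_le_sum fun s _ => M.law_exists_le_lrProd_le hj hD b s n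
    _ = _ := by simp

/-- A lower bound for the mean of a stopping time with `P(T ≤ n) ≤ n a`. -/
theorem ofReal_le_lintegral_of_measure_le (μ : Measure (Obs E)) [IsProbabilityMeasure μ]
    {T : Obs E → ℕ∞} (hT : IsStoppingTime (obsFiltration E) T) {a : ℝ} (ha : 0 < a)
    (h : ∀ n : ℕ, μ {ω | T ω ≤ n} ≤ n * ENNReal.ofReal a) :
    ENNReal.ofReal (1 / (4 * a) - 1 / 2) ≤ ∫⁻ ω, (T ω : ℝ≥0∞) ∂μ := by
  -- For every `i < n` the tail probability is at least `1 / 2`, so the mean is at least `n / 2`;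
  -- rounding down costs at most `1 / 2`.
  set n : ℕ := ⌊1 / (2 * a)⌋₊
  have hn : (n : ℝ) ≤ 1 / (2 * a) := Nat.floor_le (by positivity)
  have hn' : 1 / (2 * a) < n + 1 := Nat.lt_floor_add_one _
  have hhalf : ∀ i ∈ Finset.range n, ENNReal.ofReal (1 / 2) ≤ μ {ω | (i : ℕ∞) < T ω} := by
    intro i hi
    have hc : {ω | (i : ℕ∞) < T ω} = {ω | T ω ≤ (i : ℕ∞)}ᶜ := by ext ω; simp
    rw [hc, prob_compl_eq_one_sub ((obsFiltration E).le i _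
      (measurableSet_obsFiltration_le hT i))]
    have hle : μ {ω | T ω ≤ (i : ℕ∞)} ≤ ENNReal.ofReal (1 / 2) := by
      refine (h i).trans ?_
      rw [← ENNReal.ofReal_natCast, ← ENNReal.ofReal_mul (Nat.cast_nonneg i)]
      refine ENNReal.ofReal_le_ofReal ?_
      have : (i : ℝ) ≤ n := by exact_mod_cast (Finset.mem_range.1 hi).le
      calc (i : ℝ) * a ≤ 1 / (2 * a) * a := by gcongr; linarith
        _ = 1 / 2 := by field_simp
    calc ENNReal.ofReal (1 / 2) = 1 - ENNReal.ofReal (1 / 2) := by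
          rw [← ENNReal.ofReal_one, ← ENNReal.ofReal_sub _ (by norm_num)]; norm_num
      _ ≤ _ := tsub_le_tsub_left hle 1
  rw [lintegral_toENNReal_eq_tsum μ hT]
  calc ENNReal.ofReal (1 / (4 * a) - 1 / 2) ≤ ENNReal.ofReal (n * (1 / 2)) := by
        refine ENNReal.ofReal_le_ofReal ?_
        have : 1 / (4 * a) = 1 / (2 * a) * (1 / 2) := by field_simp; norm_num
        linarith
    _ = ∑ i ∈ Finset.range n, ENNReal.ofReal (1 / 2) := by
        rw [ENNReal.ofReal_mul (Nat.cast_nonneg n)]; simp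
    _ ≤ ∑ i ∈ Finset.range n, μ {ω | (i : ℕ∞) < T ω} := Finset.sum_le_sum hhalf
    _ ≤ _ := ENNReal.sum_le_tsum _

theorem ofReal_le_meanTimeToFalseAlarm_cusumTime (M : SensorModel K E) {k : Fin K}
    (hk : M.FiniteKL k) (b : ℝ) :
    ENNReal.ofReal (Real.exp b / 4 - 1 / 2) ≤ M.meanTimeToFalseAlarm (M.cusumTime k b) := by
  have := ofReal_le_lintegral_of_measure_le (M.law fun _ => ∅)
    (M.isStoppingTime_cusumTime k b) (Real.exp_pos (-b))
    fun n => M.law_cusumTime_le_le hk (by simp) b n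
  rw [meanTimeToFalseAlarm, noChange_eq_law]
  refine le_of_eq_of_le ?_ this
  rw [Real.exp_neg]
  congr 2
  field_simp

theorem ofReal_le_meanTimeToFalseAlarm_multichart (M : SensorModel K E)
    (hfin : ∀ k, M.FiniteKL k) (hK : 0 < K) {b : Fin K → ℝ} {β : ℝ} (hb : ∀ k, β ≤ b k) :
    ENNReal.ofReal (Real.exp β / (4 * K) - 1 / 2) ≤
      M.meanTimeToFalseAlarm (M.multichart b) := by
  have hK' : (0 : ℝ) < K := by exact_mod_cast hK
  have h : ∀ n : ℕ, M.law (fun _ => ∅) {ω | M.multichart b ω ≤ n} ≤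
      n * ENNReal.ofReal (K * Real.exp (-β)) := by
    intro n
    have hsub : {ω | M.multichart b ω ≤ (n : ℕ∞)} ⊆
        ⋃ k ∈ (Finset.univ : Finset (Fin K)), {ω | M.cusumTime k (b k) ω ≤ (n : ℕ∞)} := by
      intro ω hω
      simpa using (M.multichart_le_iff b ω n).1 hω
    calc _ ≤ _ := measure_mono hsub
      _ ≤ _ := measure_biUnion_finset_le _ _
      _ ≤ ∑ k : Fin K, n * ENNReal.ofReal (Real.exp (-β)) := by
          refine Finset.sum_le_sum fun k _ =>
            (M.law_cusumTime_le_le (hfin k) (by simp) (b k) n).trans ?_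
          gcongr
          exact hb k
      _ = _ := by
          rw [ENNReal.ofReal_mul hK'.le]
          simp [mul_left_comm]
  have := ofReal_le_lintegral_of_measure_le (M.law fun _ => ∅)
    (M.isStoppingTime_multichart b) (by positivity) h
  rw [meanTimeToFalseAlarm, noChange_eq_law]
  refine le_of_eq_of_le ?_ this
  rw [Real.exp_neg]
  congr 2
  field_simp

end SensorModel

end FalseAlarm

end MultichartCusum

namespace MultichartCusum

/-! ### Random walks with positive drift -/

section Wald

/-- A form of Wald's identity: the expected time at which a random walk with bounded above
increments and positive drift reaches the level `b`. -/
theorem sum_measureReal_forall_partialSum_lt_le {Ω : Type*} [MeasurableSpace Ω] {P : Measure Ω}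
    [IsProbabilityMeasure P] {Y : ℕ → Ω → ℝ} (hY : ∀ i, Measurable (Y i)) (hind : iIndepFun Y P)
    (hint : ∀ i, Integrable (Y i) P) {m : ℝ} (hm : 0 < m) (hmean : ∀ i, ∫ ω, Y i ω ∂P = m)
    {b c : ℝ} (hb : 0 ≤ b) (hc0 : 0 ≤ c) (hc : ∀ i ω, Y i ω ≤ c) (n : ℕ) :
    ∑ i ∈ Finset.range n, P.real {ω | ∀ j ≤ i, ∑ l ∈ Finset.range j, Y l ω < b} ≤
      (b + c) / m := by
  -- The walk is still below `b` through time `i`. This depends on `Y 0, ..., Y (i - 1)` only, hence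
  -- is independent of `Y i`.
  set A : ℕ → Set Ω := fun i => {ω | ∀ j ≤ i, ∑ l ∈ Finset.range j, Y l ω < b}
  have hle : ∀ n, MeasurableSpace.comap (Y n) inferInstance ≤ ‹MeasurableSpace Ω› :=
    fun n => (hY n).comap_le
  have hAm' : ∀ i, MeasurableSet[⨆ n ∈ {n : ℕ | n < i},
      MeasurableSpace.comap (Y n) inferInstance] (A i) := by
    intro i
    have : A i = ⋂ j ∈ {j | j ≤ i}, {ω | ∑ l ∈ Finset.range j, Y l ω < b} := by
      ext ω; simp [A]
    rw [this]
    refine MeasurableSet.biInter (Set.to_countable _) fun j hj => ?_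
    refine measurableSet_lt (Finset.measurable_fun_sum _ fun l hl => ?_) measurable_const
    exact (comap_measurable (Y l)).mono
      (le_iSup₂_of_le l ((Finset.mem_range.1 hl).trans_le hj) le_rfl) le_rfl
  have hAm : ∀ i, MeasurableSet (A i) := fun i => (iSup₂_le fun n _ => hle n) _ (hAm' i)
  have hindep : ∀ i, IndepFun ((A i).indicator fun _ => (1 : ℝ)) (Y i) P := by
    intro i
    have hdisj : Disjoint {n : ℕ | n < i} {n : ℕ | n = i} :=
      Set.disjoint_left.2 fun n (h1 : n < i) (h2 : n = i) => absurd h2 h1.ne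
    have hI := indep_iSup_of_disjoint hle hind hdisj
    refine indep_of_indep_of_le_left (indep_of_indep_of_le_right hI ?_) ?_
    · exact le_iSup₂_of_le i rfl le_rfl
    · exact Measurable.comap_le (measurable_const.indicator (hAm' i))
  -- The sum is the walk stopped at its first passage: below `b` before the last step, which adds at
  -- most `c`. The first conjunct identifies it with the walk and keeps the induction going.
  have hpath : ∀ (n : ℕ) (ω : Ω),
      (ω ∈ A n → ∑ i ∈ Finset.range n, (A i).indicator (Y i) ω = ∑ i ∈ Finset.range n, Y i ω) ∧
        ∑ i ∈ Finset.range n, (A i).indicator (Y i) ω ≤ b + c := by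
    intro n ω
    induction n with
    | zero => simpa using add_nonneg hb hc0
    | succ n ih =>
      by_cases h : ω ∈ A n
      · have heq : ∑ i ∈ Finset.range (n + 1), (A i).indicator (Y i) ω =
            ∑ i ∈ Finset.range (n + 1), Y i ω := by
          rw [Finset.sum_range_succ, ih.1 h, Set.indicator_of_mem h, Finset.sum_range_succ]
        refine ⟨fun _ => heq, ?_⟩
        rw [heq, Finset.sum_range_succ]
        exact add_le_add (h n le_rfl).le (hc n ω)
      · rw [Finset.sum_range_succ, Set.indicator_of_notMem h, add_zero]
        exact ⟨fun h' => absurd (fun j hj => h' j (hj.trans n.le_succ)) h, ih.2⟩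
  have hintA : ∀ i, Integrable ((A i).indicator (Y i)) P := fun i => (hint i).indicator (hAm i)
  have hval : ∀ i, ∫ ω, (A i).indicator (Y i) ω ∂P = P.real (A i) * m := by
    intro i
    have h := (hindep i).integral_mul_eq_mul_integral
      (measurable_const.indicator (hAm i)).aestronglyMeasurable (hint i).aestronglyMeasurable
    rw [hmean i, integral_indicator (hAm i)] at h
    simp only [integral_const, smul_eq_mul, mul_one, measureReal_restrict_apply_univ] at h
    rw [← h]
    refine integral_congr_ae (Eventually.of_forall fun ω => ?_)
    by_cases hω : ω ∈ A i <;> simp [hω]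
  rw [le_div_iff₀ hm, Finset.sum_mul]
  calc ∑ i ∈ Finset.range n, P.real (A i) * m
      = ∫ ω, ∑ i ∈ Finset.range n, (A i).indicator (Y i) ω ∂P := by
        rw [integral_finsetSum _ fun i _ => hintA i]
        exact Finset.sum_congr rfl fun i _ => (hval i).symm
    _ ≤ ∫ _, (b + c) ∂P :=
        integral_mono (integrable_finsetSum _ fun i _ => hintA i) (integrable_const _)
          fun ω => (hpath n ω).2
    _ = b + c := by simp

/-- If the averages of a sequence converge to `I > 0`, all its increments before time `n` are
eventually smaller than `(1 + δ) n I`. -/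
theorem eventually_forall_sub_lt {z : ℕ → ℝ} {I δ : ℝ} (hI : 0 < I) (hδ : 0 < δ)
    (hz : Tendsto (fun n : ℕ => z n / n) atTop (𝓝 I)) :
    ∀ᶠ n : ℕ in atTop, ∀ t ≤ n, ∀ s ≤ t, z t - z s < (1 + δ) * n * I := by
  -- The errors at `t` and `s` add up to at most `2 C + 2 η n`, which is below `4 η n = δ n I` once
  -- `C < η n`.
  set η := δ * I / 4 with hη
  have hηpos : 0 < η := by positivity
  obtain ⟨N, hN⟩ := Metric.tendsto_atTop.1 hz η hηpos
  set C := ∑ i ∈ Finset.range (N + 1), |z i - i * I|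
  have hC0 : 0 ≤ C := Finset.sum_nonneg fun _ _ => abs_nonneg _
  have hbd : ∀ t : ℕ, |z t - t * I| ≤ C + η * t := by
    intro t
    by_cases ht : t < N + 1
    · have : |z t - t * I| ≤ C := Finset.single_le_sum (f := fun i : ℕ => |z i - i * I|)
        (fun _ _ => abs_nonneg _) (Finset.mem_range.2 ht)
      have : 0 ≤ η * t := by positivity
      linarith
    · have htpos : (0 : ℝ) < t := by exact_mod_cast (show 0 < t by omega)
      have h := hN t (by omega)
      rw [Real.dist_eq] at h
      have : z t - t * I = (z t / t - I) * t := by field_simp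
      rw [this, abs_mul, abs_of_pos htpos]
      nlinarith
  obtain ⟨n₀, hn₀⟩ := exists_nat_gt (C / η)
  filter_upwards [eventually_ge_atTop n₀] with n hn t ht s hs
  have h1 := (abs_le.1 (hbd t)).2
  have h2 := (abs_le.1 (hbd s)).1
  have htn : (t : ℝ) ≤ n := by exact_mod_cast ht
  have hst : (s : ℝ) ≤ t := by exact_mod_cast hs
  have hs0 : (0 : ℝ) ≤ s := Nat.cast_nonneg s
  have hCn : C < η * n := by
    have : (n₀ : ℝ) ≤ n := by exact_mod_cast hn
    rw [div_lt_iff₀ hηpos] at hn₀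
    nlinarith
  have e1 : η * t ≤ η * n := by gcongr
  have e2 : η * s ≤ η * n := by gcongr; linarith
  have e3 : ((t : ℝ) - s) * I ≤ n * I := by gcongr; linarith
  have e4 : (1 + δ) * n * I = n * I + 4 * (η * n) := by rw [hη]; ring
  rw [e4]
  linarith

end Wald

/-! ### Bounds for Lorden's delay and the law of large numbers -/

section Delay

variable {K : ℕ} {E : Fin K → Type*} [∀ k, MeasurableSpace (E k)]

namespace SensorModel

/-- A rule that is dominated by every restart of `T'` has delay at most the mean of `T'`. -/
theorem delay_le_lintegral (M : SensorModel K E) (A : Finset (Fin K)) {T T' : Obs E → ℕ∞}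
    (hT' : Measurable fun ω => (T' ω : ℝ≥0∞))
    (h : ∀ (ν : ℕ) (ω : Obs E), T ω ≤ T' (shift ν ω) + ν) :
    M.delay A T ≤ ∫⁻ ω, (T' ω : ℝ≥0∞) ∂M.law fun _ => A := by
  refine iSup_le fun ν => essSup_le_of_ae_le _ ?_
  have hm := (obsFiltration E).le ν
  rw [change_eq_law]
  refine ae_le_of_ae_le_trim (hm := hm) ?_
  -- Tested on an event `B` of `F_ν`, the restarted rule is independent of `B` and sees only
  -- observations with the sensors of `A` post-change.
  refine ae_le_of_forall_setLIntegral_le_of_sigmaFinite (measurable_condLExp _ _ _)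
    fun B hB _ => ?_
  rw [setLIntegral_condLExp_trim hm _ _ hB, setLIntegral_trim hm measurable_const hB,
    setLIntegral_const]
  have hlaw : (fun n => if ν ≤ n + ν then A else ∅) = fun _ : ℕ => A := by ext; simp
  have := M.setLIntegral_law_comp_shift (fun n => if ν ≤ n then A else ∅) ν hB hT'
  rw [hlaw] at this
  rw [mul_comm, ← this]
  refine lintegral_mono fun ω => ?_
  exact ENat.toENNReal_mono (tsub_le_iff_right.2 (h ν ω))

theorem setLIntegral_le_delay_mul (M : SensorModel K E) (A : Finset (Fin K)) (T : Obs E → ℕ∞)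
    (ν : ℕ) {B : Set (Obs E)} (hB : MeasurableSet[obsFiltration E ν] B) :
    ∫⁻ ω in B, ((T ω - (ν : ℕ∞) : ℕ∞) : ℝ≥0∞) ∂M.change A ν ≤
      M.delay A T * M.change A ν B := by
  have hm := (obsFiltration E).le ν
  have : IsProbabilityMeasure (M.change A ν) := by rw [change_eq_law]; infer_instance
  rw [← setLIntegral_condLExp hm (M.change A ν) _ hB, ← setLIntegral_const]
  refine lintegral_mono_ae (ae_restrict_of_ae ?_)
  filter_upwards [ae_le_essSup (f := condLExp (obsFiltration E ν) (M.change A ν)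
    fun ω => ((T ω - (ν : ℕ∞) : ℕ∞) : ℝ≥0∞)) (μ := M.change A ν)] with ω hω
  exact hω.trans (le_iSup (fun ν : ℕ => essSup
    (condLExp (obsFiltration E ν) (M.change A ν) fun ω => ((T ω - (ν : ℕ∞) : ℕ∞) : ℝ≥0∞))
    (M.change A ν)) ν)

theorem lintegral_le_delay (M : SensorModel K E) (A : Finset (Fin K)) (T : Obs E → ℕ∞) :
    ∫⁻ ω, (T ω : ℝ≥0∞) ∂M.law (fun _ => A) ≤ M.delay A T := by
  have := M.setLIntegral_le_delay_mul A T 0 MeasurableSet.univ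
  rw [change_zero_eq_law] at this
  simpa using this

/-- The real-valued log-likelihood ratio of one observation. -/
noncomputable def realLogLR (M : SensorModel K E) (k : Fin K) (x : E k) : ℝ :=
  Real.log ((M.post k x : ℝ) / (M.pre k x : ℝ))

theorem measurable_realLogLR (M : SensorModel K E) (k : Fin K) : Measurable (M.realLogLR k) :=
  Real.measurable_log.comp ((M.measurable_post k).coe_nnreal_real.div
    (M.measurable_pre k).coe_nnreal_real)

/-- Almost surely under the post-change law `g_k > 0`, hence `h_k > 0`, so the ratio is positive and
finite. -/
theorem ae_lr_eq_exp_realLogLR (M : SensorModel K E) {k : Fin K} (hk : M.FiniteKL k) :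
    ∀ᵐ x ∂M.postLaw k, M.lr k x = ENNReal.ofReal (Real.exp (M.realLogLR k x)) := by
  rw [postLaw, ae_withDensity_iff (M.measurable_post k).coe_nnreal_ennreal]
  filter_upwards [hk.1] with x hx hg
  have hg' : M.post k x ≠ 0 := by simpa using hg
  have hh' : M.pre k x ≠ 0 := fun h => hg' (hx h)
  have hpos : (0 : ℝ) < (M.post k x : ℝ) / (M.pre k x : ℝ) := by
    have := pos_iff_ne_zero.2 hg'
    have := pos_iff_ne_zero.2 hh'
    positivity
  rw [lr, realLogLR, Real.exp_log hpos, ENNReal.ofReal_div_of_pos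
    (by exact_mod_cast pos_iff_ne_zero.2 hh'), ENNReal.ofReal_coe_nnreal,
    ENNReal.ofReal_coe_nnreal]

theorem integrable_realLogLR (M : SensorModel K E) {k : Fin K} (hk : M.FiniteKL k) :
    Integrable (M.realLogLR k) (M.postLaw k) := by
  rw [postLaw, integrable_withDensity_iff_integrable_smul (M.measurable_post k)]
  refine hk.2.congr (Eventually.of_forall fun x => ?_)
  simp [klIntegrand, realLogLR, NNReal.smul_def, mul_comm]

theorem integral_realLogLR (M : SensorModel K E) (k : Fin K) :
    ∫ x, M.realLogLR k x ∂M.postLaw k = M.klNumber k := by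
  rw [postLaw, integral_withDensity_eq_integral_smul (M.measurable_post k), klNumber]
  refine integral_congr_ae (Eventually.of_forall fun x => ?_)
  simp [klIntegrand, realLogLR, NNReal.smul_def, mul_comm]

theorem measurePreserving_law_eval (M : SensorModel K E) {A : Finset (Fin K)} {k : Fin K}
    (hkA : k ∈ A) (i : ℕ) :
    MeasurePreserving (fun ω : Obs E => ω i k) (M.law fun _ => A) (M.postLaw k) := by
  have h1 := measurePreserving_eval_infinitePi (fun _ : ℕ => M.obsLaw A) i
  have h2 := measurePreserving_eval
    (fun k => if k ∈ A then M.postLaw k else M.preLaw k) k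
  simp only [hkA, if_true] at h2
  exact h2.comp h1

theorem integral_law_comp_eval (M : SensorModel K E) {A : Finset (Fin K)} {k : Fin K}
    (hkA : k ∈ A) (i : ℕ) {φ : E k → ℝ} (hφ : Measurable φ) :
    ∫ ω : Obs E, φ (ω i k) ∂(M.law fun _ => A) = ∫ x, φ x ∂M.postLaw k := by
  rw [← (M.measurePreserving_law_eval hkA i).map_eq,
    integral_map (M.measurePreserving_law_eval hkA i).measurable.aemeasurable
      hφ.aestronglyMeasurable]

theorem iIndepFun_law_comp_eval (M : SensorModel K E) (A : Finset (Fin K)) {k : Fin K}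
    {φ : E k → ℝ} (hφ : Measurable φ) :
    iIndepFun (fun (i : ℕ) (ω : Obs E) => φ (ω i k)) (M.law fun _ => A) :=
  iIndepFun_infinitePi (X := fun _ (x : ∀ k, E k) => φ (x k)) fun _ => hφ.comp (measurable_pi_apply k)

theorem ae_lrProd_eq_exp_sum (M : SensorModel K E) {A : Finset (Fin K)} {k : Fin K}
    (hk : M.FiniteKL k) (hkA : k ∈ A) :
    ∀ᵐ ω ∂M.law fun _ => A, ∀ s t : ℕ, M.lrProd k s t ω =
      ENNReal.ofReal (Real.exp (∑ i ∈ Finset.Ico s t, M.realLogLR k (ω i k))) := by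
  have : ∀ᵐ ω ∂M.law fun _ => A, ∀ i : ℕ,
      M.lr k (ω i k) = ENNReal.ofReal (Real.exp (M.realLogLR k (ω i k))) :=
    ae_all_iff.2 fun i =>
      (M.measurePreserving_law_eval hkA i).quasiMeasurePreserving.ae (M.ae_lr_eq_exp_realLogLR hk)
  filter_upwards [this] with ω hω s t
  rw [lrProd, Real.exp_sum, ENNReal.ofReal_prod_of_nonneg fun i _ => (Real.exp_pos _).le]
  exact Finset.prod_congr rfl fun i _ => hω i

/-- Dominated convergence. Capping the increments bounds the overshoot in Wald's identity while
losing arbitrarily little drift. -/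
theorem exists_truncation (M : SensorModel K E) {k : Fin K} (hk : M.FiniteKL k) {a : ℝ}
    (ha : a < M.klNumber k) :
    ∃ c : ℝ, 0 ≤ c ∧ a < ∫ x, min (M.realLogLR k x) c ∂M.postLaw k := by
  have h : Tendsto (fun n : ℕ => ∫ x, min (M.realLogLR k x) n ∂M.postLaw k) atTop
      (𝓝 (∫ x, M.realLogLR k x ∂M.postLaw k)) := by
    refine tendsto_integral_of_dominated_convergence (fun x => |M.realLogLR k x|)
      (fun n => ((M.measurable_realLogLR k).min measurable_const).aestronglyMeasurable)
      (M.integrable_realLogLR hk).abs (fun n => Eventually.of_forall fun x => ?_)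
      (Eventually.of_forall fun x => ?_)
    · rw [Real.norm_eq_abs]
      have hn : (0 : ℝ) ≤ n := Nat.cast_nonneg n
      rcases le_total (M.realLogLR k x) n with h | h
      · rw [min_eq_left h]
      · rw [min_eq_right h, abs_of_nonneg hn]
        exact h.trans (le_abs_self _)
    · obtain ⟨N, hN⟩ := exists_nat_ge (M.realLogLR k x)
      refine tendsto_const_nhds.congr' ?_
      filter_upwards [eventually_ge_atTop N] with n hn
      exact (min_eq_left (hN.trans (by exact_mod_cast hn))).symm
  rw [integral_realLogLR] at h
  obtain ⟨n, hn⟩ := (h.eventually (lt_mem_nhds ha)).exists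
  exact ⟨n, Nat.cast_nonneg n, hn⟩

/-- The mean detection time of the CUSUM rule when the change occurs at the beginning. -/
theorem exists_lintegral_cusumTime_le (M : SensorModel K E) {A : Finset (Fin K)} {k : Fin K}
    (hk : M.FiniteKL k) (hpos : 0 < M.klNumber k) (hkA : k ∈ A) {ε : ℝ} (hε : 0 < ε) :
    ∃ C : ℝ, 0 ≤ C ∧ ∀ b : ℝ, 0 < b →
      ∫⁻ ω, (M.cusumTime k b ω : ℝ≥0∞) ∂M.law (fun _ => A) ≤
        ENNReal.ofReal ((1 + ε) * (b / M.klNumber k) + C) := by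
  -- A drift `m > I_k / (1 + ε)` turns Wald's bound `(b + c) / m` into `(1 + ε) b / I_k` plus a
  -- constant independent of `b`.
  obtain ⟨c, hc0, hc⟩ := M.exists_truncation hk (a := M.klNumber k / (1 + ε))
    (by rw [div_lt_iff₀ (by positivity)]; nlinarith)
  set m := ∫ x, min (M.realLogLR k x) c ∂M.postLaw k
  have hm : 0 < m := lt_trans (by positivity) hc
  refine ⟨(1 + ε) * (c / M.klNumber k), by positivity, fun b hb => ?_⟩
  have hφ : Measurable fun x => min (M.realLogLR k x) c :=
    (M.measurable_realLogLR k).min measurable_const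
  have hφi : Integrable (fun x => min (M.realLogLR k x) c) (M.postLaw k) :=
    (M.integrable_realLogLR hk).inf (integrable_const c)
  have hwald := sum_measureReal_forall_partialSum_lt_le (P := M.law fun _ => A)
    (Y := fun i ω => min (M.realLogLR k (ω i k)) c)
    (fun i => hφ.comp (M.measurePreserving_law_eval hkA i).measurable)
    (M.iIndepFun_law_comp_eval A hφ)
    (fun i => (M.measurePreserving_law_eval hkA i).integrable_comp_of_integrable hφi) hm
    (fun i => M.integral_law_comp_eval hkA i hφ)
    hb.le hc0 (fun _ _ => min_le_right _ _)
  rw [lintegral_toENNReal_eq_tsum _ (M.isStoppingTime_cusumTime k b)]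
  refine ENNReal.tsum_le_of_sum_range_le fun n => ?_
  have hle : ∀ i : ℕ, M.law (fun _ => A) {ω | (i : ℕ∞) < M.cusumTime k b ω} ≤
      ENNReal.ofReal ((M.law fun _ => A).real {ω | ∀ j ≤ i,
        ∑ l ∈ Finset.range j, min (M.realLogLR k (ω l k)) c < b}) := by
    intro i
    rw [ofReal_measureReal]
    refine measure_mono_ae ?_
    filter_upwards [M.ae_lrProd_eq_exp_sum hk hkA] with ω hω hi j hj
    have hi' : ¬ M.cusumTime k b ω ≤ (i : ℕ∞) := not_le.2 hi
    rw [cusumTime_le_iff] at hi'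
    push Not at hi'
    rcases Nat.eq_zero_or_pos j with rfl | hj0
    · simpa using hb
    -- Only the starting time `0` is needed: no CUSUM alarm forces the walk from `0`, and so the
    -- smaller truncated walk, below `b`.
    · have := hi' j hj 0 hj0
      rw [hω, ENNReal.ofReal_lt_ofReal_iff (Real.exp_pos _), Real.exp_lt_exp,
        Nat.Ico_zero_eq_range] at this
      exact (Finset.sum_le_sum fun l _ => min_le_left _ _).trans_lt this
  calc _ ≤ _ := Finset.sum_le_sum fun i _ => hle i
    _ = ENNReal.ofReal _ := (ENNReal.ofReal_sum_of_nonneg fun i _ => measureReal_nonneg).symm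
    _ ≤ _ := by
      refine ENNReal.ofReal_le_ofReal ((hwald n).trans ?_)
      rw [← mul_add, ← add_div, div_le_iff₀ hm, mul_assoc, div_mul_eq_mul_div, ← mul_div_assoc,
        le_div_iff₀ hpos]
      have : M.klNumber k < m * (1 + ε) := (div_lt_iff₀ (by positivity)).1 hc
      nlinarith

/-- The law of large numbers for the increments of the log-likelihood ratio process. -/
theorem tendsto_law_exists_le_lrProd (M : SensorModel K E) {A : Finset (Fin K)} {k : Fin K}
    (hk : M.FiniteKL k) (hpos : 0 < M.klNumber k) (hkA : k ∈ A) {δ : ℝ} (hδ : 0 < δ) :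
    Tendsto (fun n : ℕ => M.law (fun _ => A) {ω | ∃ t ≤ n, ∃ s ≤ t,
      ENNReal.ofReal (Real.exp ((1 + δ) * n * M.klNumber k)) ≤ M.lrProd k s t ω})
      atTop (𝓝 0) := by
  have hmp := fun i => M.measurePreserving_law_eval hkA i
  have hint : ∀ i, Integrable (fun ω : Obs E => M.realLogLR k (ω i k)) (M.law fun _ => A) :=
    fun i => (hmp i).integrable_comp_of_integrable (M.integrable_realLogLR hk)
  have hslln := strong_law_ae_real (fun i (ω : Obs E) => M.realLogLR k (ω i k)) (hint 0)
    (fun i j hij => (M.iIndepFun_law_comp_eval A (M.measurable_realLogLR k)).indepFun hij)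
    (fun i => (IdentDistrib.mk (hmp i).measurable.aemeasurable (hmp 0).measurable.aemeasurable
      (by rw [(hmp i).map_eq, (hmp 0).map_eq])).comp (M.measurable_realLogLR k))
  rw [M.integral_law_comp_eval hkA 0 (M.measurable_realLogLR k), integral_realLogLR] at hslln
  rw [← measure_empty (μ := M.law fun _ => A)]
  refine tendsto_measure_of_ae_tendsto_indicator_of_isFiniteMeasure atTop MeasurableSet.empty
    (fun n => ?_) ?_
  · have : {ω | ∃ t ≤ n, ∃ s ≤ t,
        ENNReal.ofReal (Real.exp ((1 + δ) * n * M.klNumber k)) ≤ M.lrProd k s t ω} =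
        ⋃ t ∈ {t | t ≤ n}, ⋃ s ∈ {s | s ≤ t},
          {ω | ENNReal.ofReal (Real.exp ((1 + δ) * n * M.klNumber k)) ≤ M.lrProd k s t ω} := by
      ext ω; simp
    rw [this]
    exact MeasurableSet.biUnion (Set.to_countable _) fun t _ =>
      MeasurableSet.biUnion (Set.to_countable _) fun s _ =>
        measurableSet_le measurable_const (M.measurable_lrProd k s t)
  · filter_upwards [hslln, M.ae_lrProd_eq_exp_sum hk hkA] with ω h1 h2
    filter_upwards [eventually_forall_sub_lt hpos hδ h1] with n hn
    simp only [Set.mem_empty_iff_false, iff_false]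
    rintro ⟨t, ht, s, hs, hL⟩
    rw [h2, ENNReal.ofReal_le_ofReal_iff (Real.exp_pos _).le, Real.exp_le_exp,
      Finset.sum_Ico_eq_sub _ hs] at hL
    exact absurd hL (not_le.2 (hn t ht s hs))

end SensorModel

end Delay

end MultichartCusum

namespace MultichartCusum

/-! ### Asymptotic lower bounds for the delay -/

section LowerBounds

/-- A finite time lies in the window `(ν, ν + n]` for at most `n` values of `ν`; an infinite one
lies in none. -/
theorem tsum_ite_lt_and_le_add_le (x : ℕ∞) (n : ℕ) :
    (∑' ν : ℕ, if (ν : ℕ∞) < x ∧ x ≤ ((ν + n : ℕ) : ℕ∞) then (1 : ℝ≥0∞) else 0) ≤ n := by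
  induction x using ENat.recTopCoe with
  | top => simp
  | coe m =>
    have h : ∀ ν : ℕ, ((ν : ℕ∞) < (m : ℕ∞) ∧ (m : ℕ∞) ≤ ((ν + n : ℕ) : ℕ∞)) ↔
        ν ∈ Finset.Ico (m - n) m := fun ν => by
      rw [Nat.cast_lt, Nat.cast_le, Finset.mem_Ico]; omega
    simp_rw [h]
    rw [tsum_eq_sum (s := Finset.Ico (m - n) m) fun ν hν => if_neg hν, Finset.sum_ite_mem,
      Finset.inter_self]
    simp only [Finset.sum_const, Nat.card_Ico, nsmul_eq_mul, mul_one, Nat.cast_le]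
    omega

theorem tendsto_floor_div {a : ℝ} (ha : 0 < a) :
    Tendsto (fun x : ℝ => ⌊x / a⌋₊) atTop atTop :=
  tendsto_nat_floor_atTop.comp (tendsto_id.atTop_div_const ha)

/-- Shared bookkeeping of the two lower bounds: with `δ = ε / 8`, the losses from `1 / (1 + 2 δ)`,
from rounding and from `1 - 2 δ` together cost at most the factor `1 - ε`. -/
theorem eventually_le_floor_div_mul {ε : ℝ} (h0 : 0 < ε) (h1 : ε < 1) :
    ∀ᶠ x : ℝ in atTop, (1 - ε) * x ≤ ⌊x / (1 + 2 * (ε / 8))⌋₊ * (1 - 2 * (ε / 8)) := by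
  filter_upwards [eventually_ge_atTop (2 / ε)] with x hx
  rw [div_le_iff₀ h0] at hx
  have hx0 : 0 ≤ x := by nlinarith
  have hf := (Nat.lt_floor_add_one (x / (1 + 2 * (ε / 8)))).le
  have hd : x * (1 - 2 * (ε / 8)) ≤ x / (1 + 2 * (ε / 8)) := by
    rw [le_div_iff₀ (by positivity)]
    nlinarith [mul_nonneg hx0 (sq_nonneg ε)]
  have h3 : x * (1 - 2 * (ε / 8)) - 1 ≤ ⌊x / (1 + 2 * (ε / 8))⌋₊ := by linarith
  calc (1 - ε) * x ≤ (x * (1 - 2 * (ε / 8)) - 1) * (1 - 2 * (ε / 8)) := by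
        nlinarith [mul_nonneg hx0 (sq_nonneg ε)]
    _ ≤ _ := by
        refine mul_le_mul_of_nonneg_right h3 ?_
        linarith

variable {K : ℕ} {E : Fin K → Type*} [∀ k, MeasurableSpace (E k)]

/-- If a stopping time has a large mean, some time window of length `n` has a small conditional
stopping probability. -/
theorem exists_measure_window_lt (μ : Measure (Obs E)) [IsProbabilityMeasure μ]
    {T : Obs E → ℕ∞} (hT : IsStoppingTime (obsFiltration E) T) (n : ℕ) {ρ : ℝ≥0∞}
    (h : (n : ℝ≥0∞) < ρ * ∫⁻ ω, (T ω : ℝ≥0∞) ∂μ) :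
    ∃ ν : ℕ, μ {ω | (ν : ℕ∞) < T ω ∧ T ω ≤ ((ν + n : ℕ) : ℕ∞)} <
      ρ * μ {ω | (ν : ℕ∞) < T ω} := by
  by_contra! hcon
  refine absurd h (not_lt.2 ?_)
  have hm : ∀ ν : ℕ, MeasurableSet {ω | (ν : ℕ∞) < T ω ∧ T ω ≤ ((ν + n : ℕ) : ℕ∞)} := fun ν =>
    ((obsFiltration E).le _ _ (measurableSet_obsFiltration_lt hT ν)).inter
      ((obsFiltration E).le _ _ (measurableSet_obsFiltration_le hT (ν + n)))
  calc ρ * ∫⁻ ω, (T ω : ℝ≥0∞) ∂μ = ∑' ν : ℕ, ρ * μ {ω | (ν : ℕ∞) < T ω} := by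
        rw [lintegral_toENNReal_eq_tsum μ hT, ENNReal.tsum_mul_left]
    _ ≤ ∑' ν : ℕ, μ {ω | (ν : ℕ∞) < T ω ∧ T ω ≤ ((ν + n : ℕ) : ℕ∞)} :=
        ENNReal.tsum_le_tsum hcon
    _ = ∫⁻ ω, ∑' ν : ℕ,
          (if (ν : ℕ∞) < T ω ∧ T ω ≤ ((ν + n : ℕ) : ℕ∞) then (1 : ℝ≥0∞) else 0) ∂μ := by
        rw [lintegral_tsum fun ν => (Measurable.ite (hm ν) measurable_const
          measurable_const).aemeasurable]
        refine tsum_congr fun ν => ?_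
        rw [← lintegral_indicator_one (hm ν)]
        refine lintegral_congr fun ω => ?_
        by_cases h : (ν : ℕ∞) < T ω ∧ T ω ≤ ((ν + n : ℕ) : ℕ∞)
        · rw [if_pos h]; exact Set.indicator_of_mem (s := {ω | _ ∧ _}) h 1
        · rw [if_neg h]; exact Set.indicator_of_notMem (s := {ω | _ ∧ _}) h 1
    _ ≤ ∫⁻ _, (n : ℝ≥0∞) ∂μ := lintegral_mono fun ω => tsum_ite_lt_and_le_add_le (T ω) n
    _ = n := by simp

namespace SensorModel

/-- A change-of-measure lower bound for the delay. -/
theorem natCast_le_mul_add_delay (M : SensorModel K E) {k : Fin K} (hk : M.FiniteKL k)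
    {T : Obs E → ℕ∞} (hT : IsStoppingTime (obsFiltration E) T) {n : ℕ} {a η : ℝ} (hη : 0 < η)
    (hE : ENNReal.ofReal ((n + 1) / η * Real.exp a) ≤ M.meanTimeToFalseAlarm T)
    (hp : M.law (fun _ => {k}) {ω | ENNReal.ofReal (Real.exp a) ≤ M.lrProd k 0 n ω} ≤
      ENNReal.ofReal η) :
    (n : ℝ≥0∞) ≤ n * ENNReal.ofReal (2 * η) + M.delay {k} T := by
  rw [meanTimeToFalseAlarm, noChange_eq_law] at hE
  set D : ℕ → Finset (Fin K) := fun _ => ∅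
  -- The factor `exp (-a)` in `ρ` pays for a likelihood ratio of size up to `exp a`; the `n + 1` in
  -- the hypothesis supplies the strict inequality.
  obtain ⟨ν, hν⟩ := exists_measure_window_lt (M.law D) hT n
    (ρ := ENNReal.ofReal (η * Real.exp (-a))) (by
      calc (n : ℝ≥0∞) < ENNReal.ofReal (n + 1) := by
            rw [ENNReal.lt_ofReal_iff_toReal_lt (by simp)]; simp
        _ = ENNReal.ofReal (η * Real.exp (-a)) *
              ENNReal.ofReal ((n + 1) / η * Real.exp a) := by
            rw [← ENNReal.ofReal_mul (by positivity)]
            congr 1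
            rw [Real.exp_neg]
            have := Real.exp_pos a
            field_simp
        _ ≤ _ := by gcongr)
  set D' : ℕ → Finset (Fin K) := fun i => if ν ≤ i then {k} else ∅
  set B := {ω | (ν : ℕ∞) < T ω}
  set G := {ω | (ν : ℕ∞) < T ω ∧ T ω ≤ ((ν + n : ℕ) : ℕ∞)}
  set L := {ω : Obs E | ENNReal.ofReal (Real.exp a) ≤ M.lrProd k ν (ν + n) ω}
  have hBm : MeasurableSet[obsFiltration E ν] B := measurableSet_obsFiltration_lt hT ν
  have hmono : obsFiltration E ν ≤ obsFiltration E (ν + n) :=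
    (obsFiltration E).mono (Nat.le_add_right ν n)
  have hGm : MeasurableSet[obsFiltration E (ν + n)] G :=
    (hmono _ hBm).inter (measurableSet_obsFiltration_le hT (ν + n))
  have hLm : MeasurableSet[obsFiltration E (ν + n)] L :=
    measurableSet_le measurable_const (M.measurable_lrProd_obsFiltration k le_rfl)
  have hBeq : M.law D' B = M.law D B :=
    M.law_apply_congr (fun i hi => by simp [D, D', not_le.2 hi]) hBm
  have h1 : M.law D' (G \ L) ≤ ENNReal.ofReal η * M.law D' B := by
    have hGL : MeasurableSet[obsFiltration E (ν + n)] (G \ L) := hGm.diff hLm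
    rw [M.law_apply_eq_setLIntegral_lrProd (D := D) (D' := D') hk (s := ν) (t := ν + n)
      (fun i hi => by simp [D, D', not_le.2 hi]) (fun i hi _ => by simp [D, D', hi]) hGL]
    calc ∫⁻ ω in G \ L, M.lrProd k ν (ν + n) ω ∂M.law D
        ≤ ∫⁻ _ in G \ L, ENNReal.ofReal (Real.exp a) ∂M.law D :=
          setLIntegral_mono' ((obsFiltration E).le _ _ hGL) fun ω hω => (not_le.1 hω.2).le
      _ = ENNReal.ofReal (Real.exp a) * M.law D (G \ L) := setLIntegral_const _ _
      _ ≤ ENNReal.ofReal (Real.exp a) * (ENNReal.ofReal (η * Real.exp (-a)) * M.law D B) := by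
          gcongr
          exact (measure_mono Set.sdiff_subset).trans hν.le
      _ = ENNReal.ofReal η * M.law D' B := by
          rw [hBeq, ← mul_assoc, ← ENNReal.ofReal_mul (Real.exp_pos a).le, Real.exp_neg]
          congr 2
          have := Real.exp_pos a
          field_simp
  -- `L` involves only observations after `ν`, so it is independent of `B` and has the probability
  -- of `L₀` for a change at time `0`.
  have h2 : M.law D' (B ∩ L) ≤ ENNReal.ofReal η * M.law D' B := by
    set L₀ := {ω : Obs E | ENNReal.ofReal (Real.exp a) ≤ M.lrProd k 0 n ω}
    have hL₀ : MeasurableSet L₀ := measurableSet_le measurable_const (M.measurable_lrProd k 0 n)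
    have hD' : (fun i => D' (i + ν)) = fun _ => {k} := by ext; simp [D']
    have h := M.setLIntegral_law_comp_shift D' ν hBm
      (g := L₀.indicator 1) (measurable_one.indicator hL₀)
    rw [hD', lintegral_indicator_one hL₀] at h
    have hset : ∀ ω, L₀.indicator (1 : Obs E → ℝ≥0∞) (shift ν ω) = L.indicator 1 ω := by
      intro ω
      have : shift ν ω ∈ L₀ ↔ ω ∈ L := by
        change _ ≤ M.lrProd k 0 n (shift ν ω) ↔ _ ≤ M.lrProd k ν (ν + n) ω
        rw [lrProd_shift, zero_add, add_comm n ν]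
      by_cases hω : ω ∈ L
      · simp [hω, this.2 hω]
      · simp [hω, mt this.1 hω]
    simp_rw [hset] at h
    have hLm' := (obsFiltration E).le _ _ hLm
    rw [lintegral_indicator_one hLm', Measure.restrict_apply hLm', Set.inter_comm] at h
    rw [h, mul_comm]
    gcongr
  have hG : M.law D' G ≤ ENNReal.ofReal (2 * η) * M.law D' B := by
    have hsub : G ⊆ (G \ L) ∪ (B ∩ L) := fun ω hω => by
      by_cases hωL : ω ∈ L
      · exact Or.inr ⟨hω.1, hωL⟩
      · exact Or.inl ⟨hω, hωL⟩
    calc M.law D' G ≤ M.law D' (G \ L) + M.law D' (B ∩ L) :=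
          (measure_mono hsub).trans (measure_union_le _ _)
      _ ≤ ENNReal.ofReal η * M.law D' B + ENNReal.ofReal η * M.law D' B := add_le_add h1 h2
      _ = _ := by rw [two_mul, ENNReal.ofReal_add hη.le hη.le, add_mul]
  set C := {ω | ((ν + n : ℕ) : ℕ∞) < T ω}
  have hCm : MeasurableSet C :=
    (obsFiltration E).le _ _ (measurableSet_obsFiltration_lt hT (ν + n))
  have hBsub : B ⊆ G ∪ C := fun ω hω => by
    by_cases h : T ω ≤ ((ν + n : ℕ) : ℕ∞)
    · exact Or.inl ⟨hω, h⟩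
    · exact Or.inr (not_le.1 h)
  have hC : n * M.law D' C ≤ M.delay {k} T * M.law D' B := by
    have h := M.setLIntegral_le_delay_mul {k} T ν hBm
    rw [change_eq_law] at h
    refine le_trans ?_ h
    have hCB : C ⊆ B := fun ω (hω : ((ν + n : ℕ) : ℕ∞) < T ω) =>
      lt_of_le_of_lt (by exact_mod_cast Nat.le_add_right ν n) hω
    calc n * M.law D' C = ∫⁻ _ in C, (n : ℝ≥0∞) ∂M.law D' := (setLIntegral_const _ _).symm
      _ ≤ ∫⁻ ω in C, ((T ω - (ν : ℕ∞) : ℕ∞) : ℝ≥0∞) ∂M.law D' := by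
          refine setLIntegral_mono' hCm fun ω hω => ?_
          have : (n : ℕ∞) ≤ T ω - (ν : ℕ∞) := by
            refine ENat.le_sub_of_add_le_left (ENat.natCast_ne_top ν) ?_
            have hω' : ((ν + n : ℕ) : ℕ∞) < T ω := hω
            push_cast at hω'
            exact hω'.le
          exact_mod_cast ENat.toENNReal_mono this
      _ ≤ _ := lintegral_mono_set hCB
  have hfinal : n * M.law D' B ≤
      (n * ENNReal.ofReal (2 * η) + M.delay {k} T) * M.law D' B := by
    calc n * M.law D' B ≤ n * (M.law D' G + M.law D' C) := by
          gcongr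
          exact (measure_mono hBsub).trans (measure_union_le _ _)
      _ ≤ n * (ENNReal.ofReal (2 * η) * M.law D' B) + M.delay {k} T * M.law D' B := by
          rw [mul_add]
          gcongr
      _ = _ := by ring
  -- The strict inequality for the window rules out a null `B`, so its probability may be cancelled.
  have hne : M.law D' B ≠ 0 := by
    rw [hBeq]
    intro h0
    rw [h0, mul_zero] at hν
    exact absurd hν not_lt_zero
  exact (ENNReal.mul_le_mul_iff_left hne (measure_ne_top _ _)).1 hfinal

/-- Lorden's asymptotic lower bound for the delay of a rule with mean time to false alarm `γ`. -/
theorem eventually_forall_le_delay (M : SensorModel K E) {k : Fin K} (hk : M.FiniteKL k)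
    (hpos : 0 < M.klNumber k) {ε : ℝ} (h0 : 0 < ε) (h1 : ε < 1) :
    ∀ᶠ γ : ℝ in atTop, ∀ T ∈ M.falseAlarmClass γ,
      ENNReal.ofReal ((1 - ε) * (Real.log γ / M.klNumber k)) ≤ M.delay {k} T := by
  set δ := ε / 8 with hδ
  have hδ0 : 0 < δ := by positivity
  set I := M.klNumber k
  have hx : Tendsto (fun γ : ℝ => Real.log γ / I) atTop atTop :=
    Real.tendsto_log_atTop.atTop_div_const hpos
  have hp : ∀ᶠ n : ℕ in atTop, M.law (fun _ => {k}) {ω | ∃ t ≤ n, ∃ s ≤ t,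
      ENNReal.ofReal (Real.exp ((1 + δ) * n * I)) ≤ M.lrProd k s t ω} ≤ ENNReal.ofReal δ :=
    (M.tendsto_law_exists_le_lrProd hk hpos (Finset.mem_singleton_self k) hδ0).eventually
      (Iic_mem_nhds (ENNReal.ofReal_pos.2 hδ0))
  have hgrow : ∀ᶠ n : ℕ in atTop, ((n : ℝ) + 1) / δ ≤ Real.exp (δ * n * I) := by
    have hq : Tendsto (fun n : ℕ => Real.exp (δ * I * n) / n) atTop atTop := by
      have h := (Real.tendsto_exp_div_pow_atTop 1).comp
        ((tendsto_natCast_atTop_atTop (R := ℝ)).const_mul_atTop (mul_pos hδ0 hpos))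
      have h' := h.const_mul_atTop (mul_pos hδ0 hpos)
      refine h'.congr' ?_
      filter_upwards [eventually_gt_atTop 0] with n hn
      have : (0 : ℝ) < n := by exact_mod_cast hn
      simp only [Function.comp_apply, pow_one]
      have := mul_pos hδ0 hpos
      field_simp
    filter_upwards [hq.eventually_ge_atTop (2 / δ), eventually_ge_atTop 1] with n hn hn1
    have hn1' : (1 : ℝ) ≤ n := by exact_mod_cast hn1
    rw [le_div_iff₀ (by linarith)] at hn
    calc ((n : ℝ) + 1) / δ ≤ 2 / δ * n := by
          rw [div_mul_eq_mul_div]; gcongr; linarith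
      _ ≤ _ := by rw [mul_right_comm]; exact hn
  have htend := (tendsto_floor_div (a := 1 + 2 * δ) (by positivity)).comp hx
  filter_upwards [htend.eventually hp, htend.eventually hgrow,
    hx.eventually (eventually_le_floor_div_mul h0 h1), eventually_gt_atTop 1]
    with γ hγ1 hγ2 hγ3 hγ4 T hT
  simp only [Function.comp_apply] at hγ1 hγ2
  rw [← hδ] at hγ3
  -- One `δ` allows for fluctuations of the log-likelihood ratio, the other absorbs the factor `(n +
  -- 1) / δ`; together the required mean is at most `exp ((1 + 2 δ) n I) ≤ γ`.
  set n := ⌊Real.log γ / I / (1 + 2 * δ)⌋₊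
  have hlog : 0 < Real.log γ := Real.log_pos hγ4
  have hn : (n : ℝ) ≤ Real.log γ / I / (1 + 2 * δ) := Nat.floor_le (by positivity)
  have hE : ENNReal.ofReal ((n + 1) / δ * Real.exp ((1 + δ) * n * I)) ≤
      M.meanTimeToFalseAlarm T := by
    refine le_trans (ENNReal.ofReal_le_ofReal ?_) hT.2
    calc (n + 1) / δ * Real.exp ((1 + δ) * n * I)
        ≤ Real.exp (δ * n * I) * Real.exp ((1 + δ) * n * I) := by gcongr
      _ = Real.exp (n * (1 + 2 * δ) * I) := by rw [← Real.exp_add]; ring_nf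
      _ ≤ Real.exp (Real.log γ) := by
          rw [le_div_iff₀ (by positivity), le_div_iff₀ hpos] at hn
          exact Real.exp_le_exp.2 hn
      _ = γ := Real.exp_log (by linarith)
  have hmain := M.natCast_le_mul_add_delay hk hT.1 hδ0 hE
    (le_trans (measure_mono fun ω hω => by exact ⟨n, le_rfl, 0, Nat.zero_le n, hω⟩) hγ1)
  refine (ENNReal.ofReal_le_ofReal hγ3).trans ?_
  rw [mul_one_sub, ENNReal.ofReal_sub _ (by positivity), ENNReal.ofReal_natCast,
    ENNReal.ofReal_mul (Nat.cast_nonneg n), ENNReal.ofReal_natCast]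
  exact tsub_le_iff_left.2 hmain

/-- The asymptotic lower bound for the delay of the multichart CUSUM in terms of `c`. -/
theorem eventually_le_delay_klMultichart (M : SensorModel K E) (hfin : ∀ k, M.FiniteKL k)
    (hpos : ∀ k, 0 < M.klNumber k) (k : Fin K) {ε : ℝ} (h0 : 0 < ε) (h1 : ε < 1) :
    ∀ᶠ c : ℝ in atTop, ENNReal.ofReal ((1 - ε) * c) ≤ M.delay {k} (M.klMultichart c) := by
  set δ := ε / 8 with hδ
  have hδ0 : 0 < δ := by positivity
  have hfloor : Tendsto (fun c : ℝ => ⌊c / (1 + 2 * δ)⌋₊) atTop atTop :=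
    tendsto_floor_div (by positivity)
  have hj : ∀ j : Fin K, Tendsto (fun c : ℝ => M.law (fun _ => {k})
      {ω | M.cusumTime j (c * M.klNumber j) ω ≤ ((⌊c / (1 + 2 * δ)⌋₊ : ℕ) : ℕ∞)})
      atTop (𝓝 0) := by
    intro j
    -- The affected chart needs growth of order `(1 + 2 δ) n I_j`, excluded by the law of large
    -- numbers. The other charts stay pre-change, where an alarm by time `n` has probability at most
    -- `n exp (-c I_j)`.
    by_cases hjk : j = k
    · subst hjk
      refine tendsto_of_tendsto_of_tendsto_of_le_of_le' tendsto_const_nhds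
        ((M.tendsto_law_exists_le_lrProd (hfin j) (hpos j) (Finset.mem_singleton_self j)
          (δ := 2 * δ) (by positivity)).comp hfloor) (Eventually.of_forall fun _ => zero_le) ?_
      filter_upwards [eventually_ge_atTop 0] with c hc
      refine measure_mono fun ω hω => ?_
      obtain ⟨t, ht, s, hs, hL⟩ := (M.cusumTime_le_iff j _ ω _).1 hω
      refine ⟨t, ht, s, hs.le, le_trans (ENNReal.ofReal_le_ofReal (Real.exp_le_exp.2 ?_)) hL⟩
      have hn : (⌊c / (1 + 2 * δ)⌋₊ : ℝ) ≤ c / (1 + 2 * δ) := Nat.floor_le (by positivity)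
      rw [le_div_iff₀ (by positivity)] at hn
      have := (hpos j).le
      rw [mul_comm (1 + 2 * δ)]
      gcongr
    · have hlim : Tendsto (fun c : ℝ => ENNReal.ofReal (c * Real.exp (-(c * M.klNumber j))))
          atTop (𝓝 0) := by
        rw [← ENNReal.ofReal_zero]
        refine ENNReal.tendsto_ofReal ?_
        have := Real.tendsto_pow_mul_exp_neg_atTop_nhds_zero 1
        have h := (this.comp (tendsto_id.atTop_mul_const (hpos j))).mul_const (M.klNumber j)⁻¹
        rw [zero_mul] at h
        refine h.congr fun c => ?_
        have := (hpos j).ne'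
        simp only [Function.comp_apply, id, pow_one]
        field_simp
      refine tendsto_of_tendsto_of_tendsto_of_le_of_le' tendsto_const_nhds hlim
        (Eventually.of_forall fun _ => zero_le) ?_
      filter_upwards [eventually_ge_atTop 0] with c hc
      refine (M.law_cusumTime_le_le (hfin j) (fun _ => by simpa using hjk) _ _).trans ?_
      rw [ENNReal.ofReal_mul hc, ← ENNReal.ofReal_natCast]
      gcongr
      exact (Nat.floor_le (by positivity)).trans (div_le_self hc (by linarith))
  have hsum := tendsto_finsetSum Finset.univ fun j _ => hj j
  rw [Finset.sum_const_zero] at hsum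
  filter_upwards [hsum.eventually (Iic_mem_nhds (ENNReal.ofReal_pos.2 (mul_pos two_pos hδ0))),
    eventually_le_floor_div_mul h0 h1] with c hc1 hc2
  rw [← hδ] at hc2
  set n := ⌊c / (1 + 2 * δ)⌋₊
  have hst : IsStoppingTime (obsFiltration E) (M.klMultichart c) :=
    M.isStoppingTime_multichart fun k => c * M.klNumber k
  have hle : M.law (fun _ => {k}) {ω | M.klMultichart c ω ≤ (n : ℕ∞)} ≤
      ENNReal.ofReal (2 * δ) := by
    have hsub : {ω | M.klMultichart c ω ≤ (n : ℕ∞)} ⊆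
        ⋃ j ∈ (Finset.univ : Finset (Fin K)),
          {ω | M.cusumTime j (c * M.klNumber j) ω ≤ (n : ℕ∞)} := by
      intro ω hω
      simpa using (M.multichart_le_iff _ ω n).1 hω
    exact (measure_mono hsub).trans ((measure_biUnion_finset_le _ _).trans hc1)
  have hgt : ENNReal.ofReal (1 - 2 * δ) ≤
      M.law (fun _ => {k}) {ω | (n : ℕ∞) < M.klMultichart c ω} := by
    have hcompl : {ω | (n : ℕ∞) < M.klMultichart c ω} =
        {ω | M.klMultichart c ω ≤ (n : ℕ∞)}ᶜ := by ext ω; simp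
    rw [hcompl, prob_compl_eq_one_sub
      ((obsFiltration E).le n _ (measurableSet_obsFiltration_le hst n)),
      ENNReal.ofReal_sub _ (by positivity), ENNReal.ofReal_one]
    exact tsub_le_tsub_left hle 1
  refine le_trans ?_ (M.lintegral_le_delay {k} (M.klMultichart c))
  calc ENNReal.ofReal ((1 - ε) * c) ≤ ENNReal.ofReal (n * (1 - 2 * δ)) :=
        ENNReal.ofReal_le_ofReal hc2
    _ ≤ n * M.law (fun _ => {k}) {ω | (n : ℕ∞) < M.klMultichart c ω} := by
        rw [ENNReal.ofReal_mul (Nat.cast_nonneg n), ENNReal.ofReal_natCast]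
        gcongr
    _ = ∫⁻ _ in {ω | (n : ℕ∞) < M.klMultichart c ω}, (n : ℝ≥0∞) ∂M.law (fun _ => {k}) :=
        (setLIntegral_const _ _).symm
    _ ≤ ∫⁻ ω in {ω | (n : ℕ∞) < M.klMultichart c ω}, (M.klMultichart c ω : ℝ≥0∞)
          ∂M.law (fun _ => {k}) :=
        setLIntegral_mono' ((obsFiltration E).le n _ (measurableSet_obsFiltration_lt hst n))
          fun ω hω => by exact_mod_cast ENat.toENNReal_mono (le_of_lt hω)
    _ ≤ _ := setLIntegral_le_lintegral _ _

end SensorModel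

end LowerBounds

end MultichartCusum

namespace MultichartCusum

/-! ### First-order asymptotics of the optimal delay and of the calibration -/

section Asymptotics

theorem tendsto_div_of_eventually_bounds {α : Type*} {l : Filter α} {g x : α → ℝ} {a : ℝ}
    (ha : 0 < a) (hx : Tendsto x l atTop)
    (h : ∀ ε : ℝ, 0 < ε → ε < 1 → ∃ C : ℝ, ∀ᶠ i in l,
      (1 - ε) * (a * x i) - C ≤ g i ∧ g i ≤ (1 + ε) * (a * x i) + C) :
    Tendsto (fun i => g i / x i) l (𝓝 a) := by
  rw [Metric.tendsto_nhds]
  intro η hη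
  -- The relative error and, once `x ≥ 4 C / η`, the additive constant each contribute at most `η x
  -- / 4`.
  set ε := min (1 / 2) (η / (4 * a)) with hεdef
  have hε0 : 0 < ε := by positivity
  have hε1 : ε < 1 := (min_le_left _ _).trans_lt (by norm_num)
  have hεη : ε * a ≤ η / 4 := by
    calc ε * a ≤ η / (4 * a) * a := by gcongr; exact min_le_right _ _
      _ = η / 4 := by field_simp
  obtain ⟨C, hC⟩ := h ε hε0 hε1
  filter_upwards [hC, hx.eventually_gt_atTop 0, hx.eventually_ge_atTop (4 * C / η)]
    with i hi hx0 hxC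
  rw [div_le_iff₀ hη] at hxC
  have h1 : ε * a * x i ≤ η / 4 * x i := by gcongr
  have hηx : 0 < η * x i := mul_pos hη hx0
  rw [Real.dist_eq, abs_sub_lt_iff]
  constructor
  · rw [sub_lt_iff_lt_add', div_lt_iff₀ hx0]
    nlinarith [hi.2]
  · rw [sub_lt_comm, lt_div_iff₀ hx0]
    nlinarith [hi.1]

/-- The upper bound makes `f` eventually finite, which reduces the claim to real numbers. -/
theorem tendsto_div_ofReal_of_eventually_bounds {α : Type*} {l : Filter α} {f : α → ℝ≥0∞}
    {x : α → ℝ} {a : ℝ} (ha : 0 < a) (hx : Tendsto x l atTop)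
    (hlow : ∀ ε : ℝ, 0 < ε → ε < 1 → ∀ᶠ i in l, ENNReal.ofReal ((1 - ε) * (a * x i)) ≤ f i)
    (hup : ∀ ε : ℝ, 0 < ε → ∃ C : ℝ, 0 ≤ C ∧ ∀ᶠ i in l,
      f i ≤ ENNReal.ofReal ((1 + ε) * (a * x i) + C)) :
    Tendsto (fun i => f i / ENNReal.ofReal (x i)) l (𝓝 (ENNReal.ofReal a)) := by
  have htop : ∀ᶠ i in l, f i ≠ ⊤ := by
    obtain ⟨C, -, hC⟩ := hup 1 one_pos
    filter_upwards [hC] with i hi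
    exact (hi.trans_lt ENNReal.ofReal_lt_top).ne
  have hreal : Tendsto (fun i => (f i).toReal / x i) l (𝓝 a) := by
    refine tendsto_div_of_eventually_bounds ha hx fun ε h0 h1 => ?_
    obtain ⟨C, hC0, hC⟩ := hup ε h0
    refine ⟨C, ?_⟩
    filter_upwards [hC, hlow ε h0 h1, htop, hx.eventually_gt_atTop 0] with i hi1 hi2 hi3 hi4
    have hax : 0 ≤ a * x i := by positivity
    constructor
    · have := (ENNReal.ofReal_le_iff_le_toReal hi3).1 hi2
      linarith
    · exact ENNReal.toReal_le_of_le_ofReal (by positivity) hi1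
  refine (ENNReal.tendsto_ofReal hreal).congr' ?_
  filter_upwards [htop, hx.eventually_gt_atTop 0] with i hi hx0
  rw [ENNReal.ofReal_div_of_pos hx0, ENNReal.ofReal_toReal hi]

variable {K : ℕ} {E : Fin K → Type*} [∀ k, MeasurableSpace (E k)]

namespace SensorModel

theorem exists_delay_cusumTime_le (M : SensorModel K E) {k : Fin K} (hk : M.FiniteKL k)
    (hpos : 0 < M.klNumber k) {ε : ℝ} (hε : 0 < ε) :
    ∃ C : ℝ, 0 ≤ C ∧ ∀ b : ℝ, 0 < b → M.delay {k} (M.cusumTime k b) ≤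
      ENNReal.ofReal ((1 + ε) * (b / M.klNumber k) + C) := by
  obtain ⟨C, hC0, hC⟩ :=
    M.exists_lintegral_cusumTime_le hk hpos (Finset.mem_singleton_self k) hε
  exact ⟨C, hC0, fun b hb => (M.delay_le_lintegral {k}
    (measurable_of_isStoppingTime (M.isStoppingTime_cusumTime k b))
    fun ν ω => M.cusumTime_le_add_shift k b ν ω).trans (hC b hb)⟩

theorem exists_delay_klMultichart_le (M : SensorModel K E) {k : Fin K} (hk : M.FiniteKL k)
    (hpos : 0 < M.klNumber k) {ε : ℝ} (hε : 0 < ε) :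
    ∃ C : ℝ, 0 ≤ C ∧ ∀ c : ℝ, 0 < c → M.delay {k} (M.klMultichart c) ≤
      ENNReal.ofReal ((1 + ε) * c + C) := by
  obtain ⟨C, hC0, hC⟩ :=
    M.exists_lintegral_cusumTime_le hk hpos (Finset.mem_singleton_self k) hε
  refine ⟨C, hC0, fun c hc => ?_⟩
  have h := hC (c * M.klNumber k) (mul_pos hc hpos)
  rw [mul_div_cancel_right₀ _ hpos.ne'] at h
  exact (M.delay_le_lintegral {k}
    (measurable_of_isStoppingTime (M.isStoppingTime_cusumTime k (c * M.klNumber k)))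
    fun ν ω => (iInf_le _ k).trans (M.cusumTime_le_add_shift k _ ν ω)).trans h

/-- The optimal delay in sensor `k` is asymptotically `log γ / I_k`. -/
theorem tendsto_optimalDelay_div_log (M : SensorModel K E) {k : Fin K} (hk : M.FiniteKL k)
    (hpos : 0 < M.klNumber k) :
    Tendsto (fun γ => M.optimalDelay {k} γ / ENNReal.ofReal (Real.log γ)) atTop
      (𝓝 (ENNReal.ofReal (M.klNumber k)⁻¹)) := by
  refine tendsto_div_ofReal_of_eventually_bounds (inv_pos.2 hpos) Real.tendsto_log_atTop
    (fun ε h0 h1 => ?_) (fun ε h0 => ?_)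
  · filter_upwards [M.eventually_forall_le_delay hk hpos h0 h1] with γ hγ
    rw [inv_mul_eq_div]
    exact le_iInf₂ hγ
  · obtain ⟨C, hC0, hC⟩ := M.exists_delay_cusumTime_le hk hpos h0
    have hlog8 : 0 ≤ Real.log 8 := Real.log_nonneg (by norm_num)
    refine ⟨(1 + ε) * (Real.log 8 / M.klNumber k) + C, by positivity, ?_⟩
    filter_upwards [eventually_ge_atTop 1] with γ hγ
    have hb : 0 < Real.log (8 * γ) := Real.log_pos (by linarith)
    -- With this threshold the false alarm bound reads `2 γ - 1 / 2`, which is at least `γ` for `γ ≥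
    -- 1`.
    have hmem : M.cusumTime k (Real.log (8 * γ)) ∈ M.falseAlarmClass γ := by
      refine ⟨M.isStoppingTime_cusumTime k _,
        le_trans (ENNReal.ofReal_le_ofReal ?_)
          (M.ofReal_le_meanTimeToFalseAlarm_cusumTime hk _)⟩
      rw [Real.exp_log (by linarith)]
      linarith
    refine (iInf₂_le _ hmem).trans ((hC _ hb).trans (ENNReal.ofReal_le_ofReal (le_of_eq ?_)))
    rw [Real.log_mul (by norm_num) (by linarith)]
    ring

/-- The calibrating constant is asymptotically `log γ / min_j I_j`. -/
theorem tendsto_calibration_div_log (M : SensorModel K E) (hfin : ∀ k, M.FiniteKL k)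
    (hpos : ∀ k, 0 < M.klNumber k) {Γ : Set ℝ} {c : ℝ → ℝ} (hc : ∀ γ ∈ Γ, 0 < c γ)
    (hcal : ∀ γ ∈ Γ, M.meanTimeToFalseAlarm (M.klMultichart (c γ)) = ENNReal.ofReal γ)
    {j : Fin K} (hj : ∀ k, M.klNumber j ≤ M.klNumber k) :
    Tendsto (fun γ => c γ / Real.log γ) (atTop ⊓ 𝓟 Γ) (𝓝 (M.klNumber j)⁻¹) := by
  have hΓ : ∀ᶠ γ in atTop ⊓ 𝓟 Γ, γ ∈ Γ := mem_inf_of_right (mem_principal_self Γ)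
  have hI := hpos j
  set I := M.klNumber j
  have hK : 0 < K := Fin.pos j
  have hK1 : (1 : ℝ) ≤ K := by exact_mod_cast hK
  refine tendsto_div_of_eventually_bounds (inv_pos.2 hI)
    (Real.tendsto_log_atTop.mono_left inf_le_left) fun ε h0 h1 => ?_
  obtain ⟨C, hC0, hC⟩ := M.exists_delay_klMultichart_le (hfin j) hI (half_pos h0)
  have hlog8 : 0 ≤ Real.log (8 * K) := Real.log_nonneg (by linarith)
  refine ⟨C + Real.log (8 * K) / I, ?_⟩
  have hlow := (M.eventually_forall_le_delay (hfin j) hI (half_pos h0)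
    (by linarith)).filter_mono (inf_le_left (b := 𝓟 Γ))
  filter_upwards [hΓ, hlow, mem_inf_of_left (Ici_mem_atTop (1 : ℝ))] with γ hγ hlowγ hγ1
  have hγ1 : (1 : ℝ) ≤ γ := hγ1
  have hcγ := hc γ hγ
  have hlog : 0 ≤ Real.log γ := Real.log_nonneg hγ1
  have hx : 0 ≤ I⁻¹ * Real.log γ := by positivity
  have hdiv : 0 ≤ Real.log (8 * K) / I := by positivity
  constructor
  · have hmem : M.klMultichart (c γ) ∈ M.falseAlarmClass γ :=
      ⟨M.isStoppingTime_multichart _, (hcal γ hγ).ge⟩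
    have h := (ENNReal.ofReal_le_ofReal_iff (by positivity)).1
      ((hlowγ _ hmem).trans (hC _ hcγ))
    rw [show Real.log γ / M.klNumber j = I⁻¹ * Real.log γ from (inv_mul_eq_div _ _).symm] at h
    set x := I⁻¹ * Real.log γ
    -- Using `ε / 2` in both delay bounds leaves room, since `(1 + ε / 2) (1 - ε) < 1 - ε / 2`.
    by_contra! hcon
    have hcx : c γ ≤ (1 - ε) * x - C := by linarith
    have : (1 + ε / 2) * c γ ≤ (1 + ε / 2) * ((1 - ε) * x - C) := by gcongr
    have hεx : 0 ≤ ε * ε * x := by positivity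
    have hεC : 0 ≤ ε * C := by positivity
    nlinarith
  · have h := M.ofReal_le_meanTimeToFalseAlarm_multichart hfin hK
      (b := fun k => c γ * M.klNumber k) (β := c γ * I) fun k => by
        have := hj k
        gcongr
    have h' := (ENNReal.ofReal_le_ofReal_iff (by linarith)).1 (h.trans_eq (hcal γ hγ))
    -- From `exp (c I) ≤ 4 K (γ + 1 / 2)` and `γ ≥ 1`.
    have hexp : Real.exp (c γ * I) ≤ 8 * K * γ := by
      rw [sub_le_iff_le_add, div_le_iff₀ (by positivity)] at h'
      nlinarith
    have hle : c γ * I ≤ Real.log (8 * K) + Real.log γ := by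
      rw [← Real.log_mul (by positivity) (by positivity)]
      exact (Real.le_log_iff_exp_le (by positivity)).2 hexp
    have : c γ ≤ Real.log (8 * K) / I + I⁻¹ * Real.log γ := by
      rw [inv_mul_eq_div, ← add_div, le_div_iff₀ hI]
      exact hle
    nlinarith

end SensorModel

end Asymptotics

end MultichartCusum


/-! ### The limit of the delay ratio and the optimality criterion -/

namespace MultichartCusum.SensorModel

variable {K : ℕ} {E : Fin K → Type*} [∀ k, MeasurableSpace (E k)]

theorem tendsto_delay_klMultichart_div_optimalDelay (M : SensorModel K E)
    (hfin : ∀ k, M.FiniteKL k) (hpos : ∀ k, 0 < M.klNumber k) {Γ : Set ℝ} {c : ℝ → ℝ}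
    (hc : ∀ γ ∈ Γ, 0 < c γ)
    (hcal : ∀ γ ∈ Γ, M.meanTimeToFalseAlarm (M.klMultichart (c γ)) = ENNReal.ofReal γ)
    (k : Fin K) :
    Tendsto (fun γ => M.delay {k} (M.klMultichart (c γ)) / M.optimalDelay {k} γ)
      (atTop ⊓ 𝓟 Γ) (𝓝 (ENNReal.ofReal (M.klNumber k / ⨅ j, M.klNumber j))) := by
  have : Nonempty (Fin K) := ⟨k⟩
  obtain ⟨j, hj⟩ := exists_eq_ciInf_of_finite (f := M.klNumber)
  have hjle : ∀ i, M.klNumber j ≤ M.klNumber i := fun i => by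
    rw [hj]; exact ciInf_le (Set.finite_range _).bddBelow i
  rw [← hj]
  have hΓ : ∀ᶠ γ in atTop ⊓ 𝓟 Γ, γ ∈ Γ := mem_inf_of_right (mem_principal_self Γ)
  have hlog : Tendsto Real.log (atTop ⊓ 𝓟 Γ) atTop :=
    Real.tendsto_log_atTop.mono_left inf_le_left
  have hcal' := M.tendsto_calibration_div_log hfin hpos hc hcal hjle
  have hctop : Tendsto c (atTop ⊓ 𝓟 Γ) atTop := by
    refine (hcal'.pos_mul_atTop (inv_pos.2 (hpos j)) hlog).congr' ?_
    filter_upwards [hlog.eventually_gt_atTop 0] with γ hγ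
    field_simp
  have hnum : Tendsto (fun γ => M.delay {k} (M.klMultichart (c γ)) / ENNReal.ofReal (c γ))
      (atTop ⊓ 𝓟 Γ) (𝓝 (ENNReal.ofReal 1)) := by
    refine tendsto_div_ofReal_of_eventually_bounds one_pos hctop (fun ε h0 h1 => ?_)
      (fun ε h0 => ?_)
    · simp_rw [one_mul]
      exact hctop.eventually (M.eventually_le_delay_klMultichart hfin hpos k h0 h1)
    · obtain ⟨C, hC0, hC⟩ := M.exists_delay_klMultichart_le (hfin k) (hpos k) h0
      refine ⟨C, hC0, ?_⟩
      filter_upwards [hΓ] with γ hγ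
      rw [one_mul]
      exact hC _ (hc γ hγ)
  have hnum' : Tendsto (fun γ => M.delay {k} (M.klMultichart (c γ)) /
      ENNReal.ofReal (Real.log γ)) (atTop ⊓ 𝓟 Γ) (𝓝 (ENNReal.ofReal (M.klNumber j)⁻¹)) := by
    have h := ENNReal.Tendsto.mul hnum (Or.inr ENNReal.ofReal_ne_top)
      (ENNReal.tendsto_ofReal hcal') (Or.inr (by simp))
    rw [ENNReal.ofReal_one, one_mul] at h
    refine h.congr' ?_
    filter_upwards [hΓ, hlog.eventually_gt_atTop 0] with γ hγ hγ0
    have hcγ := ENNReal.ofReal_pos.2 (hc γ hγ)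
    rw [ENNReal.ofReal_div_of_pos hγ0, ← mul_div_assoc,
      ENNReal.div_mul_cancel hcγ.ne' ENNReal.ofReal_ne_top]
  have hden := (M.tendsto_optimalDelay_div_log (hfin k) (hpos k)).mono_left
    (inf_le_left (b := 𝓟 Γ))
  have hk' : 0 < (M.klNumber k)⁻¹ := inv_pos.2 (hpos k)
  have hdiv := ENNReal.Tendsto.div hnum' (Or.inr (ENNReal.ofReal_pos.2 hk').ne') hden
    (Or.inr ENNReal.ofReal_ne_top)
  rw [← ENNReal.ofReal_div_of_pos hk', inv_div_inv] at hdiv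
  refine hdiv.congr' ?_
  filter_upwards [hlog.eventually_gt_atTop 0] with γ hγ
  rw [div_eq_mul_inv (M.delay _ _), div_eq_mul_inv (M.optimalDelay _ _),
    ENNReal.mul_div_mul_right _ _ (ENNReal.inv_ne_zero.2 ENNReal.ofReal_ne_top)
      (ENNReal.inv_ne_top.2 (ENNReal.ofReal_pos.2 hγ).ne')]

end MultichartCusum.SensorModel

theorem proposition3 {K : ℕ} {E : Fin K → Type*} [∀ k, MeasurableSpace (E k)]
    (M : MultichartCusum.SensorModel K E)
    (hfin : ∀ k, M.FiniteKL k) (hpos : ∀ k, 0 < M.klNumber k)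
    (Γ : Set ℝ) (hΓ : ¬ BddAbove Γ) (c : ℝ → ℝ) (hc : ∀ γ ∈ Γ, 0 < c γ)
    (hcal : ∀ γ ∈ Γ, M.meanTimeToFalseAlarm (M.klMultichart (c γ)) = ENNReal.ofReal γ) :
    (∀ k : Fin K,
      Tendsto (fun γ => M.delay {k} (M.klMultichart (c γ)) / M.optimalDelay {k} γ)
        (atTop ⊓ 𝓟 Γ) (𝓝 (ENNReal.ofReal (M.klNumber k / ⨅ j, M.klNumber j)))) ∧
    (M.FirstOrderOptimal {A | A.card = 1} Γ (fun γ => M.klMultichart (c γ)) ↔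
      ∀ j k : Fin K, M.klNumber j = M.klNumber k) := by
  have hlim := M.tendsto_delay_klMultichart_div_optimalDelay hfin hpos hc hcal
  -- Unboundedness of `Γ` makes limits unique; only the deduction of equal numbers from optimality
  -- uses it.
  have hne : (atTop ⊓ 𝓟 Γ).NeBot := by
    rw [inf_principal_neBot_iff]
    intro U hU
    obtain ⟨a, ha⟩ := mem_atTop_sets.1 hU
    obtain ⟨x, hx, hax⟩ := not_bddAbove_iff.1 hΓ a
    exact ⟨x, ha x hax.le, hx⟩
  have hinf : ∀ k : Fin K, 0 < ⨅ j, M.klNumber j := fun k => by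
    have : Nonempty (Fin K) := ⟨k⟩
    obtain ⟨j, hj⟩ := exists_eq_ciInf_of_finite (f := M.klNumber)
    exact hj ▸ hpos j
  refine ⟨hlim, fun h => ?_, fun h => ⟨fun γ hγ =>
    ⟨M.isStoppingTime_multichart _, (hcal γ hγ).ge⟩, fun A hA => ?_⟩⟩
  · have hmin : ∀ k, M.klNumber k = ⨅ j, M.klNumber j := by
      intro k
      have h1 := tendsto_nhds_unique (hlim k) (h.2 {k} (Finset.card_singleton k))
      rwa [ENNReal.ofReal_eq_one, div_eq_one_iff_eq (hinf k).ne'] at h1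
    intro j k
    rw [hmin j, hmin k]
  · obtain ⟨k, rfl⟩ := Finset.card_eq_one.1 hA
    have : Nonempty (Fin K) := ⟨k⟩
    have hk : ⨅ j, M.klNumber j = M.klNumber k := by
      simp_rw [fun j => h j k]
      exact ciInf_const
    have h1 := hlim k
    rwa [hk, div_self (hpos k).ne', ENNReal.ofReal_one] at h1
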